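/- Let $A$ be a prime C*-algebra (every nonzero closed two-sided ideal $I$ of $A$ is essential, i.e. $aI=\{0\}$ implies $a=0$), let $G$ be a finite group with neutral element $e$, and let $\alpha : G\to\mathrm{Aut}(A)$ be a faithful action of $G$ on $A$ by *-automorphisms, i.e. a group homomorphism with $\alpha_g\neq\mathrm{id}$ for all $g\neq e$. For a C*-algebra $B$, let $M_{loc}(B)$ denote its local multiplier algebra, that is, the C*-algebraic inductive limit of the multiplier algebras $M(I)$, where $I$ runs over the closed essential two-sided ideals of $B$ (directed by reverse inclusion) and, for $J\subseteq I$, the connecting map $M(I)\to M(J)$ is restriction. Let $A\rtimes_\alpha G$ be the crossed product, consisting of all functions $f:G\to A$ with $(f\cdot h)(g)=\sum_{p\in G}f(p)\,\alpha_p(h(p^{-1}g))$ and $f^*(g)=\alpha_g(f(g^{-1})^*)$, equipped with its C*-norm, and regard $A$ as a subalgebra of $M_{loc}(A)$, and also of $A\rtimes_\alpha G\subseteq M_{loc}(A\rtimes_\alpha G)$ via $a\mapsto a\delta_e$. Then the following are equivalent: (i) $\alpha$ is properly outer: for no $g\in G$ with $g\neq e$ does there exist a unitary $u\in M_{loc}(A)$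 such that $\alpha_g(a)=uau^*$ for all $a\in A$; (ii) $\alpha$ is strictly outer: $A'\cap M_{loc}(A\rtimes_\alpha G)=\mathbb{C}\cdot 1$, where $A'\cap M_{loc}(A\rtimes_\alpha G)$ is the set of elements of $M_{loc}(A\rtimes_\alpha G)$ commuting with every element of $A$. -/

import Mathlib

set_option linter.unusedSectionVars false

noncomputable section

open Filter Topology MultiplierAlgebra

namespace CStarDynamics

universe u v

section Ideals

variable {A : Type u} [NonUnitalCStarAlgebra A]

/-- Every C*-algebra has a two-sided approximate unit bounded by one. -/
theorem exists_approxUnit (B : Type*) [NonUnitalCStarAlgebra B] :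
    ∃ l : Filter B, l.NeBot ∧ (∀ᶠ e in l, ‖e‖ ≤ 1) ∧
      (∀ b : B, Tendsto (fun e ↦ e * b) l (𝓝 b)) ∧ (∀ b : B, Tendsto (fun e ↦ b * e) l (𝓝 b)) := by
  let _ : PartialOrder B := CStarAlgebra.spectralOrder B
  have : StarOrderedRing B := CStarAlgebra.spectralOrderedRing B
  have h := CStarAlgebra.increasingApproximateUnit B
  exact ⟨CStarAlgebra.approximateUnit B, h.neBot, h.eventually_norm, h.tendsto_mul_right,
    h.tendsto_mul_left⟩

theorem smul_mem_of_isClosed {I : TwoSidedIdeal A} (hI : IsClosed (I : Set A)) (c : ℂ) {x : A}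
    (hx : x ∈ I) : c • x ∈ I := by
  obtain ⟨l, _, -, -, h⟩ := exists_approxUnit A
  have h1 : Tendsto (fun e ↦ x * (c • e)) l (𝓝 (c • x)) := by
    simpa only [mul_smul_comm] using (h x).const_smul c
  exact hI.mem_of_tendsto h1 (Eventually.of_forall fun e ↦ I.mul_mem_right _ _ hx)

/-- The *-subalgebra `I ∩ I*` of a closed two-sided ideal `I`. -/
def selfAdjointPart (I : TwoSidedIdeal A) (hI : IsClosed (I : Set A)) :
    NonUnitalStarSubalgebra ℂ A where
  carrier := {x | x ∈ I ∧ star x ∈ I}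
  add_mem' ha hb := ⟨I.add_mem ha.1 hb.1, by simpa using I.add_mem ha.2 hb.2⟩
  zero_mem' := ⟨I.zero_mem, by simp [I.zero_mem]⟩
  mul_mem' ha hb := ⟨I.mul_mem_right _ _ ha.1, by simpa using I.mul_mem_right _ _ hb.2⟩
  smul_mem' c x hx := ⟨smul_mem_of_isClosed hI c hx.1, by
    simpa using smul_mem_of_isClosed hI (star c) hx.2⟩
  star_mem' h := ⟨h.2, by simpa using h.1⟩

/-- A closed two-sided ideal of a C*-algebra is self-adjoint. -/
theorem star_mem_of_isClosed {I : TwoSidedIdeal A} (hI : IsClosed (I : Set A)) {x : A}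
    (hx : x ∈ I) : star x ∈ I := by
  let B := selfAdjointPart I hI
  have hB : IsClosed (B : Set A) := hI.inter (hI.preimage continuous_star)
  let a : B := ⟨star x * x, I.mul_mem_left _ _ hx, by simpa using I.mul_mem_left _ _ hx⟩
  obtain ⟨l, _, h1, h2, -⟩ := exists_approxUnit B
  have key : Tendsto (fun e : B ↦ (e : A) * star x) l (𝓝 (star x)) := by
    rw [tendsto_iff_norm_sub_tendsto_zero]
    have h3 : Tendsto (fun e : B ↦ 2 * ‖e * a - a‖) l (𝓝 0) := by
      simpa using (tendsto_iff_norm_sub_tendsto_zero.1 (h2 a)).const_mul 2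
    have h4 : Tendsto (fun e : B ↦ ‖(e : A) * star x - star x‖ ^ 2) l (𝓝 0) := by
      refine squeeze_zero' (Eventually.of_forall fun e ↦ by positivity) ?_ h3
      filter_upwards [h1] with e he
      have e1 : ((e : A) * star x - star x) * star ((e : A) * star x - star x)
          = ((e * a - a : B) : A) * star (e : A) - ((e * a - a : B) : A) := by
        simp only [star_sub, star_mul, star_star, NonUnitalStarSubalgebra.coe_sub,
          NonUnitalStarSubalgebra.coe_mul, a]
        noncomm_ring
      rw [sq, ← CStarRing.norm_self_mul_star, e1]
      refine (norm_sub_le _ _).trans ?_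
      have e2 : ‖((e * a - a : B) : A) * star (e : A)‖ ≤ ‖e * a - a‖ * 1 := by
        refine (norm_mul_le _ _).trans ?_
        rw [norm_star]
        exact mul_le_mul_of_nonneg_left he (norm_nonneg _)
      have e3 : ‖((e * a - a : B) : A)‖ = ‖e * a - a‖ := rfl
      linarith
    have h5 := h4.sqrt
    simpa using h5
  exact hI.mem_of_tendsto key (Eventually.of_forall fun e ↦ I.mul_mem_right _ _ e.2.1)

/-- A two-sided ideal `I` is essential if `a I = 0` forces `a = 0`. -/
def IsEssential (I : TwoSidedIdeal A) : Prop :=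
  ∀ a : A, (∀ x ∈ I, a * x = 0) → a = 0

variable (A) in
/-- A C*-algebra is prime if each of its nonzero closed two-sided ideals is essential. -/
def IsPrimeCStar : Prop :=
  ∀ I : TwoSidedIdeal A, IsClosed (I : Set A) → I ≠ ⊥ → IsEssential I

variable (A) in
/-- The closed essential two-sided ideals of `A`. -/
structure EssIdeal where
  /-- the underlying two-sided ideal -/
  ideal : TwoSidedIdeal A
  isClosed : IsClosed (ideal : Set A)
  essential : IsEssential ideal

namespace EssIdeal

/-- Essential ideals are ordered by *reverse* inclusion. -/
instance : Preorder (EssIdeal A) where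
  le I J := J.ideal ≤ I.ideal
  le_refl _ := le_refl _
  le_trans _ _ _ h h' := le_trans h' h

theorem le_def {I J : EssIdeal A} : I ≤ J ↔ J.ideal ≤ I.ideal := Iff.rfl

instance : IsDirectedOrder (EssIdeal A) where
  directed I J := by
    refine ⟨⟨I.ideal ⊓ J.ideal, ?_, ?_⟩, le_def.2 inf_le_left, le_def.2 inf_le_right⟩
    · convert I.isClosed.inter J.isClosed using 1
      ext x
      exact TwoSidedIdeal.mem_inf A
    · intro a h
      refine I.essential a fun x hx ↦ J.essential _ fun y hy ↦ ?_
      rw [mul_assoc]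
      exact h _ ((TwoSidedIdeal.mem_inf A).2
        ⟨I.ideal.mul_mem_right _ _ hx, J.ideal.mul_mem_left _ _ hy⟩)

variable (A) in
/-- `A` as an essential ideal of itself. -/
def whole : EssIdeal A where
  ideal := ⊤
  isClosed := by simp
  essential a h := by simpa using h (star a) (TwoSidedIdeal.mem_top _)

instance : Nonempty (EssIdeal A) := ⟨whole A⟩

/-- A closed essential ideal as a *-subalgebra. -/
def toSub (I : EssIdeal A) : NonUnitalStarSubalgebra ℂ A where
  carrier := I.ideal
  add_mem' := I.ideal.add_mem
  zero_mem' := I.ideal.zero_mem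
  mul_mem' ha _ := I.ideal.mul_mem_right _ _ ha
  smul_mem' c _ hx := smul_mem_of_isClosed I.isClosed c hx
  star_mem' := star_mem_of_isClosed I.isClosed

instance (I : EssIdeal A) : NonUnitalCStarAlgebra I.toSub :=
  NonUnitalStarSubalgebra.nonUnitalCStarAlgebra I.toSub (h_closed := I.isClosed)

/-- The inclusion `J ⊆ I` of essential ideals. -/
def incl {I J : EssIdeal A} (h : I ≤ J) (x : J.toSub) : I.toSub := ⟨x, h x.2⟩

end EssIdeal

end Ideals

section Restriction

variable {A : Type u} [NonUnitalCStarAlgebra A]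

theorem fst_mul {B : Type*} [NonUnitalCStarAlgebra B] (m : 𝓜(ℂ, B)) (a b : B) :
    m.fst (a * b) = m.fst a * b := by
  rw [← sub_eq_zero]
  set c := m.fst (a * b) - m.fst a * b with hc
  have h : ∀ d : B, d * c = 0 := fun d ↦ by
    rw [hc, mul_sub, ← m.central, ← mul_assoc d, ← m.central, mul_assoc, sub_self]
  simpa using h (star c)

theorem snd_mul {B : Type*} [NonUnitalCStarAlgebra B] (m : 𝓜(ℂ, B)) (a b : B) :
    m.snd (a * b) = a * m.snd b := by
  rw [← sub_eq_zero]
  set c := m.snd (a * b) - a * m.snd b with hc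
  have h : ∀ d : B, c * d = 0 := fun d ↦ by
    rw [hc, sub_mul, m.central, mul_assoc, mul_assoc, m.central, sub_self]
  simpa using h (star c)

open EssIdeal

theorem fst_mem {I J : EssIdeal A} (h : I ≤ J) (m : 𝓜(ℂ, I.toSub)) (x : J.toSub) :
    (m.fst (incl h x) : A) ∈ J.toSub := by
  obtain ⟨l, _, -, h2, -⟩ := exists_approxUnit J.toSub
  have hc : Continuous fun y : J.toSub ↦ (m.fst (incl h y) : A) := by
    have : Continuous (incl h) := by unfold incl; fun_prop
    fun_prop
  refine J.isClosed.mem_of_tendsto ((hc.tendsto x).comp (h2 x)) (Eventually.of_forall fun e ↦ ?_)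
  have : m.fst (incl h (e * x)) = m.fst (incl h e) * incl h x :=
    fst_mul m (incl h e) (incl h x)
  simp only [Function.comp_apply, this]
  exact J.ideal.mul_mem_left _ _ x.2

theorem snd_mem {I J : EssIdeal A} (h : I ≤ J) (m : 𝓜(ℂ, I.toSub)) (x : J.toSub) :
    (m.snd (incl h x) : A) ∈ J.toSub := by
  obtain ⟨l, _, -, -, h2⟩ := exists_approxUnit J.toSub
  have hc : Continuous fun y : J.toSub ↦ (m.snd (incl h y) : A) := by
    have : Continuous (incl h) := by unfold incl; fun_prop
    fun_prop
  refine J.isClosed.mem_of_tendsto ((hc.tendsto x).comp (h2 x)) (Eventually.of_forall fun e ↦ ?_)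
  have : m.snd (incl h (x * e)) = incl h x * m.snd (incl h e) :=
    snd_mul m (incl h x) (incl h e)
  simp only [Function.comp_apply, this]
  exact J.ideal.mul_mem_right _ _ x.2

/-- The restriction map `M(I) → M(J)` for essential ideals `J ⊆ I`: both components of a double
centralizer of `I` map `J` into `J`. -/
def restrict {I J : EssIdeal A} (h : I ≤ J) : 𝓜(ℂ, I.toSub) →⋆ₐ[ℂ] 𝓜(ℂ, J.toSub) where
  toFun m :=
    { fst := LinearMap.mkContinuous
        { toFun := fun x ↦ ⟨m.fst (incl h x), fst_mem h m x⟩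
          map_add' := fun x y ↦ Subtype.ext <|
            congrArg (fun z : I.toSub ↦ (z : A)) (map_add m.fst (incl h x) (incl h y))
          map_smul' := fun c x ↦ Subtype.ext <|
            congrArg (fun z : I.toSub ↦ (z : A)) (map_smul m.fst c (incl h x)) }
        ‖m.fst‖ (fun x ↦ m.fst.le_opNorm (incl h x))
      snd := LinearMap.mkContinuous
        { toFun := fun x ↦ ⟨m.snd (incl h x), snd_mem h m x⟩
          map_add' := fun x y ↦ Subtype.ext <|
            congrArg (fun z : I.toSub ↦ (z : A)) (map_add m.snd (incl h x) (incl h y))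
          map_smul' := fun c x ↦ Subtype.ext <|
            congrArg (fun z : I.toSub ↦ (z : A)) (map_smul m.snd c (incl h x)) }
        ‖m.snd‖ (fun x ↦ m.snd.le_opNorm (incl h x))
      central := fun x y ↦ Subtype.ext <|
        congrArg (fun z : I.toSub ↦ (z : A)) (m.central (incl h x) (incl h y)) }
  map_one' := rfl
  map_mul' _ _ := rfl
  map_zero' := rfl
  map_add' _ _ := rfl
  commutes' _ := rfl
  map_star' _ := rfl

@[simp] theorem coe_restrict_fst {I J : EssIdeal A} (h : I ≤ J) (m : 𝓜(ℂ, I.toSub))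
    (x : J.toSub) : ((restrict h m).fst x : A) = m.fst (incl h x) := rfl

@[simp] theorem coe_restrict_snd {I J : EssIdeal A} (h : I ≤ J) (m : 𝓜(ℂ, I.toSub))
    (x : J.toSub) : ((restrict h m).snd x : A) = m.snd (incl h x) := rfl

theorem restrict_injective {I J : EssIdeal A} (h : I ≤ J) :
    Function.Injective (restrict h : 𝓜(ℂ, I.toSub) → 𝓜(ℂ, J.toSub)) := by
  rw [injective_iff_map_eq_zero]
  intro m hm
  have h0 : ∀ y : I.toSub, m.fst y = 0 := fun y ↦ Subtype.ext <| J.essential _ fun x hx ↦ by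
    have h1 : m.fst (y * incl h ⟨x, hx⟩) = m.fst y * incl h ⟨x, hx⟩ := fst_mul m _ _
    have h2 : m.fst (incl h (⟨y * x, J.ideal.mul_mem_left _ _ hx⟩ : J.toSub)) = 0 := by
      apply Subtype.ext
      rw [← coe_restrict_fst, hm]
      rfl
    exact (congrArg Subtype.val h1).symm.trans (congrArg Subtype.val h2)
  have h1 : ∀ y : I.toSub, m.snd y = 0 := fun y ↦ by
    have := m.central y (star (m.snd y))
    rw [h0, mul_zero] at this
    simpa using this
  ext y
  · simp [h0]
  · simp [h1]

theorem norm_restrict {I J : EssIdeal A} (h : I ≤ J) (m : 𝓜(ℂ, I.toSub)) :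
    ‖restrict h m‖ = ‖m‖ :=
  NonUnitalStarAlgHom.norm_map (restrict h) (restrict_injective h) m

instance : DirectedSystem (fun I : EssIdeal A ↦ 𝓜(ℂ, I.toSub))
    (fun _ _ h ↦ (restrict h : _ → _)) where
  map_self _ _ := rfl
  map_map _ _ _ _ _ _ := rfl

end Restriction

section LocalMultipliers

variable (A : Type u) [NonUnitalCStarAlgebra A]

/-- The algebraic direct limit of the multiplier algebras `M(I)`, over all closed essential
ideals `I` of `A`. -/
def PreMloc : Type u :=
  DirectLimit (fun I : EssIdeal A ↦ 𝓜(ℂ, I.toSub)) (fun _ _ h ↦ restrict h)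

namespace PreMloc

instance : Ring (PreMloc A) :=
  inferInstanceAs <| Ring
    (DirectLimit (fun I : EssIdeal A ↦ 𝓜(ℂ, I.toSub)) (fun _ _ h ↦ restrict h))

instance : StarRing (PreMloc A) :=
  inferInstanceAs <| StarRing
    (DirectLimit (fun I : EssIdeal A ↦ 𝓜(ℂ, I.toSub)) (fun _ _ h ↦ restrict h))

instance : Module ℂ (PreMloc A) :=
  inferInstanceAs <| Module ℂ
    (DirectLimit (fun I : EssIdeal A ↦ 𝓜(ℂ, I.toSub)) (fun _ _ h ↦ restrict h))

instance : StarModule ℂ (PreMloc A) :=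
  inferInstanceAs <| StarModule ℂ
    (DirectLimit (fun I : EssIdeal A ↦ 𝓜(ℂ, I.toSub)) (fun _ _ h ↦ restrict h))

variable {A}

/-- The canonical map `M(I) → lim M(I)`, as a function. -/
def mk (I : EssIdeal A) (m : 𝓜(ℂ, I.toSub)) : PreMloc A :=
  (⟦⟨I, m⟩⟧ : DirectLimit (fun I : EssIdeal A ↦ 𝓜(ℂ, I.toSub)) (fun _ _ h ↦ restrict h))

theorem mk_one (I : EssIdeal A) : mk I 1 = 1 := (DirectLimit.one_def I).symm

theorem mk_zero (I : EssIdeal A) : mk I 0 = 0 := (DirectLimit.zero_def I).symm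

theorem mk_add (I : EssIdeal A) (m n : 𝓜(ℂ, I.toSub)) : mk I (m + n) = mk I m + mk I n :=
  (DirectLimit.add_def (G := fun I : EssIdeal A ↦ 𝓜(ℂ, I.toSub))
    (f := fun (I J : EssIdeal A) (h : I ≤ J) ↦ restrict h) I m n).symm

theorem mk_star (I : EssIdeal A) (m : 𝓜(ℂ, I.toSub)) : mk I (star m) = star (mk I m) := rfl

theorem mk_mul (I : EssIdeal A) (m n : 𝓜(ℂ, I.toSub)) : mk I (m * n) = mk I m * mk I n :=
  (DirectLimit.mul_def (G := fun I : EssIdeal A ↦ 𝓜(ℂ, I.toSub))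
    (f := fun (I J : EssIdeal A) (h : I ≤ J) ↦ restrict h) I m n).symm

theorem mk_smul (I : EssIdeal A) (c : ℂ) (m : 𝓜(ℂ, I.toSub)) : mk I (c • m) = c • mk I m := rfl

theorem exists_mk₂ (x y : PreMloc A) :
    ∃ (I : EssIdeal A) (m n : 𝓜(ℂ, I.toSub)), mk I m = x ∧ mk I n = y := by
  obtain ⟨I, m, n, h, h'⟩ := DirectLimit.exists_eq_mk₂
    (fun (I J : EssIdeal A) (h : I ≤ J) ↦ restrict h) x y
  exact ⟨I, m, n, h.symm, h'.symm⟩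

instance : Algebra ℂ (PreMloc A) :=
  Algebra.ofModule
    (fun c x y ↦ by
      obtain ⟨I, m, n, rfl, rfl⟩ := exists_mk₂ x y
      rw [← mk_smul, ← mk_mul, ← mk_mul, ← mk_smul, smul_mul_assoc])
    (fun c x y ↦ by
      obtain ⟨I, m, n, rfl, rfl⟩ := exists_mk₂ x y
      rw [← mk_smul, ← mk_mul, ← mk_mul, ← mk_smul, mul_smul_comm])

/-- The canonical map `M(I) → lim M(I)`. -/
def of (I : EssIdeal A) : 𝓜(ℂ, I.toSub) →⋆ₐ[ℂ] PreMloc A where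
  toFun m := mk I m
  map_one' := mk_one I
  map_mul' x y := mk_mul I x y
  map_zero' := mk_zero I
  map_add' x y := mk_add I x y
  commutes' c := by
    rw [Algebra.algebraMap_eq_smul_one, Algebra.algebraMap_eq_smul_one, mk_smul, mk_one]
  map_star' x := mk_star I x

theorem of_restrict {I J : EssIdeal A} (h : I ≤ J) (m : 𝓜(ℂ, I.toSub)) :
    of J (restrict h m) = of I m :=
  DirectLimit.mk_apply (F := fun I : EssIdeal A ↦ 𝓜(ℂ, I.toSub))
    (f := fun (I J : EssIdeal A) (h : I ≤ J) ↦ restrict h) I J m h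

theorem exists_of₂ (x y : PreMloc A) :
    ∃ (I : EssIdeal A) (m n : 𝓜(ℂ, I.toSub)), of I m = x ∧ of I n = y := exists_mk₂ x y

theorem exists_of (x : PreMloc A) : ∃ (I : EssIdeal A) (m : 𝓜(ℂ, I.toSub)), of I m = x := by
  obtain ⟨I, m, -, h, -⟩ := exists_of₂ x x
  exact ⟨I, m, h⟩

/-- The norm of the direct limit: all the maps `M(I) → lim M(I)` are isometric. -/
instance : Norm (PreMloc A) where
  norm := DirectLimit.lift (fun (I J : EssIdeal A) (h : I ≤ J) ↦ restrict h)
    (fun _ m ↦ ‖m‖) (fun _ _ h m ↦ (norm_restrict h m).symm)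

@[simp] theorem norm_of (I : EssIdeal A) (m : 𝓜(ℂ, I.toSub)) : ‖of I m‖ = ‖m‖ := rfl

instance : NormedRing (PreMloc A) where
  __ := (inferInstance : Ring (PreMloc A))
  __ := AddGroupNorm.toNormedAddCommGroup (E := PreMloc A)
    { toFun := norm
      map_zero' := by
        rw [← map_zero (of (EssIdeal.whole A)), norm_of, norm_zero]
      add_le' := fun x y ↦ by
        obtain ⟨I, m, n, rfl, rfl⟩ := exists_of₂ x y
        rw [← map_add]
        exact norm_add_le m n
      neg' := fun x ↦ by
        obtain ⟨I, m, rfl⟩ := exists_of x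
        rw [← map_neg]
        exact norm_neg m
      eq_zero_of_map_eq_zero' := fun x h ↦ by
        obtain ⟨I, m, rfl⟩ := exists_of x
        rw [norm_of, norm_eq_zero] at h
        rw [h, map_zero] }
  norm_mul_le x y := by
    obtain ⟨I, m, n, rfl, rfl⟩ := exists_of₂ x y
    rw [← map_mul]
    exact norm_mul_le m n

instance : NormedAlgebra ℂ (PreMloc A) where
  norm_smul_le c x := by
    obtain ⟨I, m, rfl⟩ := exists_of x
    rw [← map_smul]
    exact norm_smul_le c m

instance : CStarRing (PreMloc A) where
  norm_mul_self_le x := by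
    obtain ⟨I, m, rfl⟩ := exists_of x
    rw [← map_star, ← map_mul, norm_of, norm_of]
    exact CStarRing.norm_mul_self_le m

end PreMloc

open UniformSpace

/-- The local multiplier algebra `M_loc(A)`: the C*-algebraic inductive limit of the multiplier
algebras `M(I)`, that is the completion of their algebraic direct limit. -/
def Mloc : Type u := Completion (PreMloc A)

namespace Mloc

instance : NormedRing (Mloc A) := inferInstanceAs <| NormedRing (Completion (PreMloc A))

instance : CompleteSpace (Mloc A) := inferInstanceAs <| CompleteSpace (Completion (PreMloc A))

instance : Algebra ℂ (Mloc A) := inferInstanceAs <| Algebra ℂ (Completion (PreMloc A))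

instance : NormedAlgebra ℂ (Mloc A) where
  norm_smul_le := norm_smul_le (α := ℂ) (β := Completion (PreMloc A))

variable {A}

/-- The canonical map from the direct limit to its completion. -/
def ofPre (x : PreMloc A) : Mloc A := (x : Completion (PreMloc A))

theorem continuous_ofPre : Continuous (ofPre : PreMloc A → Mloc A) :=
  Completion.continuous_coe (PreMloc A)

theorem ofPre_mul (x y : PreMloc A) : ofPre (x * y) = ofPre x * ofPre y := Completion.coe_mul x y

theorem ofPre_add (x y : PreMloc A) : ofPre (x + y) = ofPre x + ofPre y := Completion.coe_add x y

theorem ofPre_smul (c : ℂ) (x : PreMloc A) : ofPre (c • x) = c • ofPre x := Completion.coe_smul c x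

theorem norm_ofPre (x : PreMloc A) : ‖ofPre x‖ = ‖x‖ := Completion.norm_coe x

@[elab_as_elim]
theorem induction {p : Mloc A → Prop} (x : Mloc A) (hp : IsClosed {x | p x})
    (ih : ∀ x : PreMloc A, p (ofPre x)) : p x :=
  Completion.induction_on x hp ih

@[elab_as_elim]
theorem induction₂ {p : Mloc A → Mloc A → Prop} (x y : Mloc A)
    (hp : IsClosed {x : Mloc A × Mloc A | p x.1 x.2})
    (ih : ∀ x y : PreMloc A, p (ofPre x) (ofPre y)) : p x y :=
  Completion.induction_on₂ x y hp ih

/-- The involution of `M_loc(A)`, extended by continuity. -/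
instance : Star (Mloc A) where
  star := Completion.map (star : PreMloc A → PreMloc A)

theorem ofPre_star (x : PreMloc A) : ofPre (star x) = star (ofPre x) :=
  (Completion.map_coe (starₗᵢ ℂ (E := PreMloc A)).isometry.uniformContinuous x).symm

theorem continuous_star' : Continuous (star : Mloc A → Mloc A) := Completion.continuous_map

instance : StarRing (Mloc A) where
  star_involutive x := by
    refine induction (A := A) x (isClosed_eq ?_ continuous_id) fun x ↦ ?_
    · exact continuous_star'.comp continuous_star'
    · rw [← ofPre_star, ← ofPre_star, star_star]
  star_mul x y := by
    have h := @continuous_star' A _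
    refine induction₂ (A := A) x y (isClosed_eq ?_ ?_) fun x y ↦ ?_
    · exact h.comp (continuous_fst.mul continuous_snd)
    · exact (h.comp continuous_snd).mul (h.comp continuous_fst)
    · rw [← ofPre_star, ← ofPre_star, ← ofPre_mul, ← ofPre_mul, ← ofPre_star, star_mul]
  star_add x y := by
    have h := @continuous_star' A _
    refine induction₂ (A := A) x y (isClosed_eq ?_ ?_) fun x y ↦ ?_
    · exact h.comp (continuous_fst.add continuous_snd)
    · exact (h.comp continuous_fst).add (h.comp continuous_snd)
    · rw [← ofPre_star, ← ofPre_star, ← ofPre_add, ← ofPre_add, ← ofPre_star, star_add]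

instance : StarModule ℂ (Mloc A) where
  star_smul c x := by
    have h := @continuous_star' A _
    refine induction (A := A) x (isClosed_eq ?_ ?_) fun x ↦ ?_
    · exact h.comp (continuous_const_smul c)
    · exact h.const_smul (star c)
    · rw [← ofPre_star, ← ofPre_smul, ← ofPre_smul, ← ofPre_star, star_smul]

instance : CStarRing (Mloc A) where
  norm_mul_self_le x := by
    have h := @continuous_star' A _
    refine induction (A := A) x (isClosed_le ?_ ?_) fun x ↦ ?_
    · exact continuous_norm.mul continuous_norm
    · exact continuous_norm.comp (h.mul continuous_id)
    · rw [← ofPre_star, ← ofPre_mul, norm_ofPre, norm_ofPre]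
      exact CStarRing.norm_mul_self_le x

instance : CStarAlgebra (Mloc A) where

/-- The canonical map `M(I) → M_loc(A)`, for an essential ideal `I` of `A`. -/
def of (I : EssIdeal A) : 𝓜(ℂ, I.toSub) →⋆ₐ[ℂ] Mloc A where
  toFun m := ofPre (PreMloc.of I m)
  map_one' := by rw [map_one]; rfl
  map_mul' x y := by rw [map_mul, ofPre_mul]
  map_zero' := by rw [map_zero]; rfl
  map_add' x y := by rw [map_add, ofPre_add]
  commutes' c := by rw [AlgHomClass.commutes]; rfl
  map_star' x := by rw [map_star, ofPre_star]

theorem norm_of (I : EssIdeal A) (m : 𝓜(ℂ, I.toSub)) : ‖of I m‖ = ‖m‖ := norm_ofPre _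

variable (A) in
/-- The canonical embedding `A → M(A) → M_loc(A)`. -/
def coe : A →⋆ₙₐ[ℂ] Mloc A where
  toFun a := of (EssIdeal.whole A)
    (DoubleCentralizer.coeHom (𝕜 := ℂ) (⟨a, TwoSidedIdeal.mem_top A⟩ : (EssIdeal.whole A).toSub))
  map_smul' c a := by rw [MonoidHom.id_apply, ← map_smul, ← map_smul]; rfl
  map_zero' := by
    refine Eq.trans ?_ (map_zero (of (EssIdeal.whole A)))
    exact congrArg _ (map_zero DoubleCentralizer.coeHom)
  map_add' a b := by rw [← map_add, ← map_add]; rfl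
  map_mul' a b := by rw [← map_mul, ← map_mul]; rfl
  map_star' a := by rw [← map_star, ← map_star]; rfl

end Mloc

end LocalMultipliers

section Crossed

variable {A : Type u} [NonUnitalCStarAlgebra A] {G : Type v} [Group G]

/-- The crossed product `A ⋊_α G` by a finite group `G`, realised on the space of all functions
`G → A`; since `G` is finite, this space is already complete in its C*-norm. -/
def CrossedProduct (_ : G →* (A ≃⋆ₐ[ℂ] A)) : Type (max u v) := G → A

namespace CrossedProduct

variable {α : G →* (A ≃⋆ₐ[ℂ] A)}

instance : AddCommGroup (CrossedProduct α) := inferInstanceAs <| AddCommGroup (G → A)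

instance : Module ℂ (CrossedProduct α) := inferInstanceAs <| Module ℂ (G → A)

instance : FunLike (CrossedProduct α) G A where
  coe f := f
  coe_injective _ _ h := h

@[ext] theorem ext {f h : CrossedProduct α} (H : ∀ g, f g = h g) : f = h := funext H

@[simp] theorem add_apply (f h : CrossedProduct α) (g : G) : (f + h) g = f g + h g := rfl

@[simp] theorem smul_apply (c : ℂ) (f : CrossedProduct α) (g : G) : (c • f) g = c • f g := rfl

@[simp] theorem zero_apply (g : G) : (0 : CrossedProduct α) g = 0 := rfl

/-- The involution `f*(g) = α_g(f(g⁻¹)*)`. -/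
instance : Star (CrossedProduct α) where
  star f := fun g ↦ α g (star (f g⁻¹))

@[simp] theorem star_apply (f : CrossedProduct α) (g : G) : (star f) g = α g (star (f g⁻¹)) := rfl

theorem act_act (α : G →* (A ≃⋆ₐ[ℂ] A)) (g h : G) (a : A) : α g (α h a) = α (g * h) a := by
  rw [map_mul]; rfl

theorem one_apply (α : G →* (A ≃⋆ₐ[ℂ] A)) (a : A) : α 1 a = a := by
  rw [map_one]; rfl

theorem continuous_action (α : G →* (A ≃⋆ₐ[ℂ] A)) (g : G) : Continuous (α g) :=
  (NonUnitalStarAlgHom.isometry (α g) (α g).injective).continuous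

attribute [local instance] CStarAlgebra.spectralOrder CStarAlgebra.spectralOrderedRing

/-- The regular representation `(π(f) ξ)(p) = ∑ q, α_{p⁻¹}(f(p q⁻¹)) ξ(q)`, written as a matrix
over `A` indexed by `G`. -/
def regRep (f : CrossedProduct α) : CStarMatrix G G A :=
  CStarMatrix.ofMatrix fun p q ↦ α p⁻¹ (f (p * q⁻¹))

theorem regRep_apply (f : CrossedProduct α) (p q : G) :
    regRep f p q = α p⁻¹ (f (p * q⁻¹)) := rfl

theorem regRep_injective : Function.Injective (regRep : CrossedProduct α → CStarMatrix G G A) := by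
  intro f h H
  ext g
  have := congrArg (α g) (congrFun (congrFun H g) 1)
  simpa only [regRep_apply, act_act, mul_inv_cancel, one_apply, inv_one, mul_one] using this

theorem regRep_add (f h : CrossedProduct α) : regRep (f + h) = regRep f + regRep h := by
  ext p q
  simp [regRep_apply]

theorem regRep_smul (c : ℂ) (f : CrossedProduct α) : regRep (c • f) = c • regRep f := by
  ext p q
  simp [regRep_apply]

variable [Fintype G]

/-- The twisted convolution `(f * h)(g) = ∑ p, f(p) α_p(h(p⁻¹ g))`. -/
instance : Mul (CrossedProduct α) where
  mul f h := fun g ↦ ∑ p : G, f p * α p (h (p⁻¹ * g))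

theorem mul_apply (f h : CrossedProduct α) (g : G) :
    (f * h) g = ∑ p : G, f p * α p (h (p⁻¹ * g)) := rfl

theorem regRep_mul (f h : CrossedProduct α) : regRep (f * h) = regRep f * regRep h := by
  ext p q
  rw [CStarMatrix.mul_apply, regRep_apply, mul_apply, map_sum]
  refine Fintype.sum_equiv ((Equiv.inv G).trans (Equiv.mulRight p)) _ _ fun r ↦ ?_
  rw [regRep_apply, regRep_apply, map_mul (α p⁻¹), act_act]
  simp [mul_assoc]

theorem regRep_star (f : CrossedProduct α) : regRep (star f) = star (regRep f) := by
  ext p q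
  rw [CStarMatrix.star_apply]
  rw [regRep_apply, regRep_apply, star_apply, act_act, inv_mul_cancel_left, mul_inv_rev, inv_inv,
    map_star]

instance : NonUnitalRing (CrossedProduct α) where
  left_distrib f h k := regRep_injective <| by
    simp only [regRep_add, regRep_mul, mul_add]
  right_distrib f h k := regRep_injective <| by
    simp only [regRep_add, regRep_mul, add_mul]
  zero_mul f := by ext g; simp [mul_apply]
  mul_zero f := by ext g; simp [mul_apply]
  mul_assoc f h k := regRep_injective <| by
    simp only [regRep_mul, mul_assoc]

instance : IsScalarTower ℂ (CrossedProduct α) (CrossedProduct α) where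
  smul_assoc c f h := regRep_injective <| by
    simp only [smul_eq_mul, regRep_mul, regRep_smul, smul_mul_assoc]

instance : SMulCommClass ℂ (CrossedProduct α) (CrossedProduct α) where
  smul_comm c f h := regRep_injective <| by
    simp only [smul_eq_mul, regRep_mul, regRep_smul, mul_smul_comm]

instance : StarRing (CrossedProduct α) where
  star_involutive f := regRep_injective <| by simp only [regRep_star, star_star]
  star_mul f h := regRep_injective <| by simp only [regRep_star, regRep_mul, star_mul]
  star_add f h := regRep_injective <| by simp only [regRep_star, regRep_add, star_add]

instance : StarModule ℂ (CrossedProduct α) where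
  star_smul c f := regRep_injective <| by simp only [regRep_star, regRep_smul, star_smul]

/-- The regular representation as a *-homomorphism. -/
def regRepHom (α : G →* (A ≃⋆ₐ[ℂ] A)) : CrossedProduct α →⋆ₙₐ[ℂ] CStarMatrix G G A where
  toFun := regRep
  map_smul' := regRep_smul
  map_zero' := by ext p q; simp [regRep_apply]
  map_add' := regRep_add
  map_mul' := regRep_mul
  map_star' := regRep_star

/-- The C*-norm of the crossed product, `‖f‖ = ‖π(f)‖` for the regular representation `π`. -/
instance : NonUnitalNormedRing (CrossedProduct α) :=
  NonUnitalNormedRing.induced (CrossedProduct α) (CStarMatrix G G A) (regRepHom α) regRep_injective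

theorem norm_def (f : CrossedProduct α) : ‖f‖ = ‖regRep f‖ := rfl

instance : NormedSpace ℂ (CrossedProduct α) where
  norm_smul_le c f := by rw [norm_def, norm_def, regRep_smul]; exact norm_smul_le _ _

instance : CStarRing (CrossedProduct α) where
  norm_mul_self_le f := by
    rw [norm_def, norm_def, regRep_mul, regRep_star]
    exact CStarRing.norm_mul_self_le _

theorem range_regRep : Set.range (regRep : CrossedProduct α → CStarMatrix G G A) =
    {M | ∀ p q, M p q = α q⁻¹ (M (p * q⁻¹) 1)} := by
  ext M
  constructor
  · rintro ⟨f, rfl⟩ p q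
    rw [regRep_apply, regRep_apply, act_act, inv_one, mul_one, mul_inv_rev, inv_inv,
      inv_mul_cancel_left]
  · intro hM
    refine ⟨fun g ↦ α g (M g 1), ?_⟩
    ext p q
    change α p⁻¹ (α (p * q⁻¹) (M (p * q⁻¹) 1)) = M p q
    rw [hM p q, act_act, inv_mul_cancel_left]

instance : CompleteSpace (CrossedProduct α) := by
  have hu : IsUniformInducing (regRep : CrossedProduct α → CStarMatrix G G A) :=
    (AddMonoidHomClass.isometry_of_norm (regRepHom α) fun f ↦ rfl).isUniformInducing
  rw [completeSpace_iff_isComplete_range hu]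
  refine IsClosed.isComplete ?_
  rw [range_regRep]
  simp only [Set.ofPred_forall]
  refine isClosed_iInter fun p ↦ isClosed_iInter fun q ↦ isClosed_eq ?_ ?_
  · exact (continuous_apply q).comp (continuous_apply p)
  · exact (continuous_action α _).comp
      ((continuous_apply (1 : G)).comp (continuous_apply (p * q⁻¹)))

instance : NonUnitalCStarAlgebra (CrossedProduct α) where

open Classical in
variable (α) in
/-- The embedding `A → A ⋊_α G`, `a ↦ a δ_e`. -/
def embed : A →⋆ₙₐ[ℂ] CrossedProduct α where
  toFun a := fun g ↦ if g = 1 then a else 0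
  map_smul' c a := by
    funext g
    change (if g = 1 then c • a else 0) = c • (if g = 1 then a else 0)
    split_ifs <;> simp
  map_zero' := by
    funext g
    change (if g = 1 then (0 : A) else 0) = 0
    simp
  map_add' a b := by
    funext g
    change (if g = 1 then a + b else 0) = (if g = 1 then a else 0) + (if g = 1 then b else 0)
    split_ifs <;> simp
  map_mul' a b := by
    funext g
    change (if g = 1 then a * b else 0) =
      ∑ p : G, (if p = 1 then a else 0) * α p (if p⁻¹ * g = 1 then b else 0)
    rw [Finset.sum_eq_single 1 (fun p _ hp ↦ by simp [hp]) (by simp)]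
    simp only [if_true, one_apply, inv_one, one_mul]
    split_ifs <;> simp
  map_star' a := by
    funext g
    change (if g = 1 then star a else 0) = α g (star (if g⁻¹ = 1 then a else 0))
    by_cases h : g = 1
    · subst h; simp
    · simp [h]

end CrossedProduct

end Crossed

section Outer

variable {A : Type u} [NonUnitalCStarAlgebra A] {G : Type v} [Group G]

/-- The action `α` is properly outer: no `α_g` with `g ≠ e` is of the form `a ↦ u a u*` for a
unitary `u` of `M_loc(A)`. -/
def ProperlyOuter (α : G →* (A ≃⋆ₐ[ℂ] A)) : Prop :=
  ∀ g : G, g ≠ 1 → ¬ ∃ u ∈ unitary (Mloc A), ∀ a : A,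
    Mloc.coe A (α g a) = u * Mloc.coe A a * star u

variable [Fintype G]

/-- The action `α` is strictly outer: the commutant of (the image of) `A` in
`M_loc(A ⋊_α G)` consists of the scalar multiples of the identity. -/
def StrictlyOuter (α : G →* (A ≃⋆ₐ[ℂ] A)) : Prop :=
  Set.centralizer (Set.range fun a : A ↦
      Mloc.coe (CrossedProduct α) (CrossedProduct.embed α a)) =
    Set.range (algebraMap ℂ (Mloc (CrossedProduct α)))

end Outer

end CStarDynamics

end

noncomputable section

open Filter Topology MultiplierAlgebra

namespace CStarDynamics

universe u v

/-! ### Prime C*-algebras and quantitative primeness -/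

section Prime

variable {A : Type u} [NonUnitalCStarAlgebra A]

/-! The equivalence comes from a Fourier decomposition: each element of M_loc(A ⋊ G) is a finite sum
∑ x_g λ_g with unique x_g in M_loc(A). Such an element commutes with A exactly when x_g α_g(a) = a
x_g for all a and g. A nonzero solution x_g forces α_g to be implemented by a unitary of M_loc(A).
Conversely, a unitary u implementing α_g yields the element u* λ_g of the commutant, which is not a
scalar when g ≠ e and A ≠ 0.

Two facts carry the argument. The first is that A has trivial commutant in M_loc(A)
(`Mloc.exists_eq_algebraMap`). If a self-adjoint x in the commutant had two spectral values,
functional calculus would give nonzero y, w with y A w = 0. Primeness excludes this in A, but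
M_loc(A) is a completion and a purely qualitative statement does not pass to limits. Hence the norm
estimate `IsPrimeCStar.exists_norm_mul_mul_le`, which survives approximation. Applied to x x* and x*
x for x = x_g, triviality of the commutant shows that both are the same positive scalar, so that x*
is a multiple of a unitary, and this unitary implements α_g (`eq_zero_or_exists_unitary`).

The second fact is that the ideals J ⋊ G, with J an invariant essential ideal of A, are cofinal
among the essential ideals of A ⋊ G (`InvIdeal.exists_le_cross`). No outerness is needed: a
Maschke-type averaging over G suffices. Multipliers of J ⋊ G have coefficients in M(J). The
coefficient maps and their inverses are bounded and compatible with restriction, so they extend to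
the local multiplier algebras (`exists_fourier`). -/

theorem eq_zero_of_forall_mul_eq_zero {a : A} (h : ∀ x : A, a * x = 0) : a = 0 := by
  simpa using h (star a)

/-- In a prime C*-algebra, `a A b = 0` forces `a = 0` or `b = 0`. -/
theorem IsPrimeCStar.eq_zero_or_eq_zero (hA : IsPrimeCStar A) {a b : A}
    (h : ∀ x, a * x * b = 0) : a = 0 ∨ b = 0 := by
  -- The right annihilator of a A is a closed two-sided ideal containing b. If b ≠ 0 it is
  -- essential, and a y annihilates it for every y, so a y = 0.
  let R : TwoSidedIdeal A := TwoSidedIdeal.mk' {c | ∀ x, a * x * c = 0} (by simp)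
    (fun hx hy z ↦ by rw [mul_add, hx z, hy z, add_zero])
    (fun hx z ↦ by rw [mul_neg, hx z, neg_zero])
    (fun {x y} hy z ↦ by rw [← mul_assoc, mul_assoc a, hy])
    (fun {x y} hx z ↦ by rw [← mul_assoc, hx, zero_mul])
  have hR : ∀ c, c ∈ R ↔ ∀ x, a * x * c = 0 := fun c ↦ TwoSidedIdeal.mem_mk' _ _ _ _ _ _ c
  by_cases hb : b = 0
  · exact .inr hb
  refine .inl (eq_zero_of_forall_mul_eq_zero fun y ↦ ?_)
  refine hA R ?_ (fun h0 ↦ hb ?_) (a * y) fun x hx ↦ (hR x).1 hx y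
  · have : (R : Set A) = ⋂ x, {c | a * x * c = 0} := by
      ext c
      simp only [SetLike.mem_coe, hR, Set.mem_iInter, Set.mem_ofPred_eq]
    rw [this]
    exact isClosed_iInter fun x ↦ isClosed_eq (by fun_prop) continuous_const
  · have : b ∈ R := (hR b).2 h
    rwa [h0, TwoSidedIdeal.mem_bot] at this

/-- Finitely many nonzero ideals of a prime C*-algebra have a common nonzero element. -/
theorem IsPrimeCStar.exists_mem_forall (hA : IsPrimeCStar A) [Nontrivial A] {ι : Type*} [Finite ι]
    (K : ι → TwoSidedIdeal A) (hK : ∀ i, ∃ a ∈ K i, a ≠ 0) : ∃ a, a ≠ 0 ∧ ∀ i, a ∈ K i := by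
  classical
  have := Fintype.ofFinite ι
  suffices H : ∀ s : Finset ι, ∃ a, a ≠ 0 ∧ ∀ i ∈ s, a ∈ K i by
    simpa using H Finset.univ
  intro s
  induction s using Finset.induction_on with
  | empty => simpa using exists_ne (0 : A)
  | insert i s _ ih =>
    obtain ⟨a, ha, hs⟩ := ih
    obtain ⟨b, hb, hb0⟩ := hK i
    obtain ⟨x, hx⟩ : ∃ x, a * x * b ≠ 0 := by
      by_contra! h
      exact (hA.eq_zero_or_eq_zero h).elim ha hb0
    -- The product lies in every ideal that contains either of its outer factors.
    refine ⟨a * x * b, hx, fun j hj ↦ ?_⟩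
    obtain rfl | hj := Finset.mem_insert.1 hj
    · exact (K j).mul_mem_left _ _ hb
    · rw [mul_assoc]
      exact (K j).mul_mem_right _ _ (hs j hj)

section Order

attribute [local instance] CStarAlgebra.spectralOrder CStarAlgebra.spectralOrderedRing

/-- An element `x` of norm greater than `s` is bounded below by `s` on some nonzero right ideal. -/
theorem exists_cutoff (x : A) {s : ℝ} (hs : 0 ≤ s) (hx : s < ‖x‖) :
    ∃ f : A, f ≠ 0 ∧ ∀ b, s * ‖f * b‖ ≤ ‖x * (f * b)‖ := by
  set p := star x * x with hp
  have hp0 : 0 ≤ p := star_mul_self_nonneg x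
  have hsa : IsSelfAdjoint p := hp0.isSelfAdjoint
  -- F vanishes on [0, s²], so f = F(x*x) lives where x*x ≥ s². It is nonzero because the spectrum
  -- of x*x reaches ‖x‖² > s².
  let F : ℝ → ℝ := fun r ↦ max (r - s ^ 2) 0
  have hF0 : F 0 = 0 := by
    have : 0 - s ^ 2 ≤ 0 := by nlinarith
    exact max_eq_right this
  have hFc : Continuous F := by fun_prop
  set f := cfcₙ F p with hf
  have hfs : star f = f := (cfcₙ_predicate F p : IsSelfAdjoint f)
  refine ⟨f, fun h0 ↦ ?_, fun b ↦ ?_⟩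
  · have h1 : ∀ r ∈ quasispectrum ℝ p, r ≤ s ^ 2 := fun r hr ↦ by
      have := norm_apply_le_norm_cfcₙ F p hr hFc.continuousOn hF0 hsa
      rw [← hf, h0, norm_zero, Real.norm_eq_abs] at this
      have h2 : r - s ^ 2 ≤ F r := le_max_left _ _
      linarith [le_abs_self (F r)]
    have h2 : ‖p‖ ≤ s ^ 2 := by
      rw [← cfcₙ_id' ℝ p hsa]
      refine norm_cfcₙ_le fun r hr ↦ ?_
      rw [Real.norm_eq_abs, abs_of_nonneg (quasispectrum_nonneg_of_nonneg p hp0 r hr)]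
      exact h1 r hr
    rw [hp, CStarRing.norm_star_mul_self] at h2
    nlinarith
  · have h1 : s ^ 2 • (f * f) ≤ f * p * f := by
      have e1 : f * p * f = cfcₙ (fun r ↦ F r * r * F r) p := by
        rw [cfcₙ_mul (fun r ↦ F r * r) F p (by fun_prop) (by simp) (by fun_prop) hF0,
          cfcₙ_mul F (fun r ↦ r) p (by fun_prop) hF0 (by fun_prop) rfl, cfcₙ_id' ℝ p hsa]
      have e2 : s ^ 2 • (f * f) = cfcₙ (fun r ↦ s ^ 2 • (F r * F r)) p := by
        rw [cfcₙ_smul (s ^ 2) (fun r ↦ F r * F r) p (by fun_prop) (by simp [hF0]),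
          cfcₙ_mul F F p (by fun_prop) hF0 (by fun_prop) hF0]
      rw [e1, e2]
      refine cfcₙ_mono (fun r _ ↦ ?_) (by fun_prop) (by fun_prop) (by simp [hF0]) (by simp)
      obtain h | h := le_total (r - s ^ 2) 0
      · simp [F, max_eq_right h]
      · have : 0 ≤ (r - s ^ 2) * (F r * F r) := mul_nonneg h (mul_self_nonneg _)
        simp only [smul_eq_mul]
        nlinarith
    have h2 := star_left_conjugate_le_conjugate h1 b
    have e1 : star b * (s ^ 2 • (f * f)) * b = s ^ 2 • (star (f * b) * (f * b)) := by
      rw [star_mul, hfs]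
      simp only [mul_smul_comm, smul_mul_assoc, mul_assoc]
    have e2 : star b * (f * p * f) * b = star (x * (f * b)) * (x * (f * b)) := by
      rw [star_mul, star_mul, hfs, hp]
      simp only [mul_assoc]
    rw [e1, e2] at h2
    have h3 := CStarAlgebra.norm_le_norm_of_nonneg_of_le
      (smul_nonneg (sq_nonneg s) (star_mul_self_nonneg (f * b))) h2
    rw [norm_smul, CStarRing.norm_star_mul_self, CStarRing.norm_star_mul_self,
      Real.norm_of_nonneg (sq_nonneg s)] at h3
    refine le_of_sq_le_sq (by nlinarith) (norm_nonneg _)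

end Order

/-- Prime C*-algebras are ultraprime with constant one. -/
theorem IsPrimeCStar.exists_norm_mul_mul_le (hA : IsPrimeCStar A) {x y : A} {s t : ℝ} (hs : 0 ≤ s)
    (ht : 0 ≤ t) (hx : s < ‖x‖) (hy : t < ‖y‖) :
    ∃ a : A, a ≠ 0 ∧ s * t * ‖a‖ ≤ ‖x * a * y‖ := by
  obtain ⟨f, hf, hf'⟩ := exists_cutoff x hs hx
  obtain ⟨h, hh, hh'⟩ := exists_cutoff (star y) ht (by rwa [norm_star])
  obtain ⟨b, hb⟩ : ∃ b, f * b * star h ≠ 0 := by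
    by_contra! H
    exact (hA.eq_zero_or_eq_zero H).elim hf (by simpa using hh)
  -- The left factor f absorbs x at the cost of s, and the right factor h* absorbs y at the cost of
  -- t.
  refine ⟨f * b * star h, hb, ?_⟩
  have h1 := hf' (b * star h * y)
  have h2 := hh' (star (f * b))
  rw [← norm_star, ← norm_star (star y * _)] at h2
  simp only [star_mul, star_star, ← mul_assoc] at h1 h2 ⊢
  calc s * t * ‖f * b * star h‖ = s * (t * ‖f * b * star h‖) := by ring
    _ ≤ s * ‖f * b * star h * y‖ := by gcongr
    _ ≤ _ := h1

end Prime

/-! ### Double centralizers -/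

section DoubleCentralizers

variable {A : Type u} [NonUnitalCStarAlgebra A]

/-- Centrality R(x) y = x L(y) determines R from L, since an element that annihilates A from the
left is zero. -/
theorem ext_fst {m n : 𝓜(ℂ, A)} (h : ∀ x, m.fst x = n.fst x) : m = n := by
  refine DoubleCentralizer.ext ℂ A m n (Prod.ext (ContinuousLinearMap.ext h)
    (ContinuousLinearMap.ext fun x ↦ ?_))
  rw [← sub_eq_zero]
  refine eq_zero_of_forall_mul_eq_zero fun y ↦ ?_
  rw [sub_mul, m.central, n.central, h, sub_self]

theorem ext_snd {m n : 𝓜(ℂ, A)} (h : ∀ x, m.snd x = n.snd x) : m = n := by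
  refine ext_fst fun x ↦ ?_
  rw [← sub_eq_zero]
  have H : ∀ y, y * (m.fst x - n.fst x) = 0 := fun y ↦ by
    rw [mul_sub, ← m.central, ← n.central, h, sub_self]
  exact (CStarRing.star_mul_self_eq_zero_iff _).1 (H (star (m.fst x - n.fst x)))

theorem mul_coeHom (m : 𝓜(ℂ, A)) (a : A) :
    m * DoubleCentralizer.coeHom (𝕜 := ℂ) a = DoubleCentralizer.coeHom (𝕜 := ℂ) (m.fst a) :=
  ext_fst fun x ↦ (fst_mul m a x)

theorem coeHom_mul (m : 𝓜(ℂ, A)) (a : A) :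
    DoubleCentralizer.coeHom (𝕜 := ℂ) a * m = DoubleCentralizer.coeHom (𝕜 := ℂ) (m.snd a) :=
  ext_snd fun x ↦ (snd_mul m x a)

theorem norm_coeHom (a : A) : ‖DoubleCentralizer.coeHom (𝕜 := ℂ) a‖ = ‖a‖ := by
  refine NonUnitalStarAlgHom.norm_map (DoubleCentralizer.coeHom (𝕜 := ℂ) : A →⋆ₙₐ[ℂ] 𝓜(ℂ, A))
    (fun a b h ↦ ?_) a
  rw [← sub_eq_zero]
  refine eq_zero_of_forall_mul_eq_zero fun x ↦ ?_
  rw [sub_mul, sub_eq_zero]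
  exact congrArg (fun m : 𝓜(ℂ, A) ↦ m.fst x) h

end DoubleCentralizers

/-! ### The commutant of A in its local multiplier algebra -/

namespace Mloc

variable {A : Type u} [NonUnitalCStarAlgebra A]

theorem of_restrict {I J : EssIdeal A} (h : I ≤ J) (m : 𝓜(ℂ, I.toSub)) :
    of J (restrict h m) = of I m :=
  congrArg ofPre (PreMloc.of_restrict h m)

theorem le_whole (J : EssIdeal A) : EssIdeal.whole A ≤ J := le_top (a := J.ideal)

/-- The multiplier of `J` defined by an element of `A`. -/
def mult (J : EssIdeal A) (a : A) : 𝓜(ℂ, J.toSub) :=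
  restrict (le_whole J) (DoubleCentralizer.coeHom (𝕜 := ℂ)
    (⟨a, TwoSidedIdeal.mem_top A⟩ : (EssIdeal.whole A).toSub))

theorem coe_eq_of_mult (J : EssIdeal A) (a : A) : coe A a = of J (mult J a) :=
  (of_restrict (le_whole J) _).symm

theorem mult_coe (J : EssIdeal A) (a : J.toSub) :
    mult J (a : A) = DoubleCentralizer.coeHom (𝕜 := ℂ) a := ext_fst fun _ ↦ rfl

theorem of_mul_coe (J : EssIdeal A) (m : 𝓜(ℂ, J.toSub)) (b : J.toSub) :
    of J m * coe A (b : A) = coe A (m.fst b : A) := by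
  rw [coe_eq_of_mult J, coe_eq_of_mult J, mult_coe, mult_coe, ← map_mul, mul_coeHom]

theorem coe_mul_of (J : EssIdeal A) (m : 𝓜(ℂ, J.toSub)) (b : J.toSub) :
    coe A (b : A) * of J m = coe A (m.snd b : A) := by
  rw [coe_eq_of_mult J, coe_eq_of_mult J, mult_coe, mult_coe, ← map_mul, coeHom_mul]

theorem norm_coe (a : A) : ‖coe A a‖ = ‖a‖ := by
  rw [coe, NonUnitalStarAlgHom.coe_mk']
  exact (norm_of _ _).trans (norm_coeHom _)

theorem exists_of_near (y w : Mloc A) {δ : ℝ} (hδ : 0 < δ) :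
    ∃ (J : EssIdeal A) (m n : 𝓜(ℂ, J.toSub)), ‖y - of J m‖ < δ ∧ ‖w - of J n‖ < δ := by
  have H : ∀ z : Mloc A, ∃ p : PreMloc A, ‖z - ofPre p‖ < δ := fun z ↦ by
    have hd : DenseRange (ofPre : PreMloc A → Mloc A) :=
      UniformSpace.Completion.denseRange_coe
    obtain ⟨p, hp⟩ := hd.exists_dist_lt z hδ
    exact ⟨p, by rwa [← dist_eq_norm]⟩
  obtain ⟨p, hp⟩ := H y
  obtain ⟨q, hq⟩ := H w
  obtain ⟨J, m, n, rfl, rfl⟩ := PreMloc.exists_of₂ p q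
  exact ⟨J, m, n, hp, hq⟩

/-- For a prime C*-algebra `A`, `y A w = 0` in `M_loc(A)` forces `y = 0` or `w = 0`. -/
theorem eq_zero_or_eq_zero (hA : IsPrimeCStar A) {y w : Mloc A}
    (h : ∀ a, y * coe A a * w = 0) : y = 0 ∨ w = 0 := by
  by_contra! hne
  have hy := norm_pos_iff.2 hne.1
  have hw := norm_pos_iff.2 hne.2
  -- With this choice the final estimate reads ‖y‖‖w‖/4 ≤ 2δ‖w‖ + δ‖y‖ ≤ (3/20)‖y‖‖w‖, which is
  -- absurd.
  obtain ⟨δ, hδ, hδy, hδw⟩ : ∃ δ : ℝ, 0 < δ ∧ 20 * δ ≤ ‖y‖ ∧ 20 * δ ≤ ‖w‖ :=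
    ⟨min ‖y‖ ‖w‖ / 20, by positivity, by linarith [min_le_left ‖y‖ ‖w‖],
      by linarith [min_le_right ‖y‖ ‖w‖]⟩
  obtain ⟨J, m, n, hm, hn⟩ := exists_of_near y w hδ
  have hm' : ‖y‖ / 2 < ‖m‖ := by
    have := norm_le_norm_add_norm_sub' y (of J m)
    rw [norm_of] at this
    linarith
  have hn' : ‖w‖ / 2 < ‖n‖ := by
    have := norm_le_norm_add_norm_sub' w (of J n)
    rw [norm_of] at this
    linarith
  have hn'' : ‖of J n‖ ≤ 2 * ‖w‖ := by
    have := norm_le_norm_add_norm_sub (of J n) w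
    rw [← norm_sub_rev] at this
    have h2 := norm_le_norm_add_norm_sub' (of J n) w
    rw [norm_sub_rev] at h2
    linarith
  rw [← DoubleCentralizer.norm_fst] at hm'
  rw [← DoubleCentralizer.norm_snd] at hn'
  obtain ⟨b, hb, hb'⟩ := m.fst.exists_lt_apply_of_lt_opNorm hm'
  obtain ⟨c, hc, hc'⟩ := n.snd.exists_lt_apply_of_lt_opNorm hn'
  obtain ⟨a, ha, ha'⟩ := hA.exists_norm_mul_mul_le (x := (m.fst b : A)) (y := (n.snd c : A))
    (by positivity) (by positivity) hb' hc'
  -- Here (m b) a (c n) = m z n. Replacing m by y and n by w costs errors proportional to δ‖a‖, and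
  -- y z w = 0. The lower bound on the norm is also proportional to ‖a‖, so ‖a‖ cancels.
  set z : A := b * a * c with hz
  have hza : ‖z‖ ≤ ‖a‖ := by
    have h1 : ‖(b : A)‖ ≤ 1 := hb.le
    have h2 : ‖(c : A)‖ ≤ 1 := hc.le
    calc ‖z‖ ≤ ‖(b : A)‖ * ‖a‖ * ‖(c : A)‖ := norm_mul₃_le
      _ ≤ 1 * ‖a‖ * 1 := by gcongr
      _ = ‖a‖ := by ring
  have e : coe A ((m.fst b : A) * a * (n.snd c : A)) =
      (of J m - y) * coe A z * of J n + y * coe A z * (of J n - w) := by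
    rw [map_mul, map_mul, ← of_mul_coe, ← coe_mul_of, sub_mul, sub_mul, mul_sub, h z, hz, map_mul,
      map_mul]
    noncomm_ring
  rw [← norm_coe ((m.fst b : A) * a * (n.snd c : A)), e] at ha'
  have hpos := norm_pos_iff.2 ha
  have b1 : ‖(of J m - y) * coe A z * of J n‖ ≤ δ * ‖a‖ * (2 * ‖w‖) := by
    refine norm_mul₃_le.trans ?_
    rw [norm_coe, norm_sub_rev]
    gcongr
  have b2 : ‖y * coe A z * (of J n - w)‖ ≤ ‖y‖ * ‖a‖ * δ := by
    refine norm_mul₃_le.trans ?_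
    rw [norm_coe, norm_sub_rev (of J n)]
    gcongr
  have b3 := ha'.trans ((norm_add_le _ _).trans (add_le_add b1 b2))
  have b4 : ‖y‖ / 2 * (‖w‖ / 2) ≤ δ * (2 * ‖w‖) + ‖y‖ * δ := by
    refine le_of_mul_le_mul_right (b3.trans (le_of_eq ?_)) hpos
    ring
  nlinarith [mul_pos hy hw]

/-- A self-adjoint element of `M_loc(A)` commuting with the prime C*-algebra `A` is a scalar. -/
theorem exists_eq_algebraMap_of_isSelfAdjoint (hA : IsPrimeCStar A) {x : Mloc A}
    (hx : IsSelfAdjoint x) (h : ∀ a, Commute x (coe A a)) : ∃ c : ℝ, x = algebraMap ℝ (Mloc A) c := by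
  cases subsingleton_or_nontrivial (Mloc A) with
  | inl _ => exact ⟨0, Subsingleton.elim _ _⟩
  | inr _ =>
    -- Two spectral values are separated at their midpoint c by F and H with F H = 0. Since F(x)
    -- commutes with A, F(x) A H(x) = 0, although neither F(x) nor H(x) vanishes.
    have key : ∀ r ∈ spectrum ℝ x, ∀ t ∈ spectrum ℝ x, ¬ r < t := fun r hr t ht hrt ↦ by
      let c := (r + t) / 2
      let F : ℝ → ℝ := fun q ↦ max (q - c) 0
      let H : ℝ → ℝ := fun q ↦ max (c - q) 0
      have hFc : Continuous F := by fun_prop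
      have hHc : Continuous H := by fun_prop
      have hmul : cfc F x * cfc H x = 0 := by
        rw [← cfc_mul F H x hFc.continuousOn hHc.continuousOn]
        have : (fun q ↦ F q * H q) = fun _ ↦ 0 := by
          ext q
          obtain h | h := le_total q c
          · simp [F, max_eq_right (sub_nonpos.2 h)]
          · simp [H, max_eq_right (sub_nonpos.2 h)]
        rw [this, cfc_const_zero]
      obtain h0 | h0 := eq_zero_or_eq_zero hA (y := cfc F x) (w := cfc H x) fun a ↦ by
        rw [((h a).cfc_real F).eq, mul_assoc, hmul, mul_zero]
      · have := norm_apply_le_norm_cfc F x ht hFc.continuousOn hx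
        rw [h0, norm_zero, Real.norm_eq_abs] at this
        have h2 : t - c ≤ F t := le_max_left _ _
        have h3 : c = (r + t) / 2 := rfl
        linarith [le_abs_self (F t)]
      · have := norm_apply_le_norm_cfc H x hr hHc.continuousOn hx
        rw [h0, norm_zero, Real.norm_eq_abs] at this
        have h2 : c - r ≤ H r := le_max_left _ _
        have h3 : c = (r + t) / 2 := rfl
        linarith [le_abs_self (H r)]
    obtain ⟨c, hc⟩ := ContinuousFunctionalCalculus.spectrum_nonempty (R := ℝ) x hx
    exact ⟨c, CFC.eq_algebraMap_of_spectrum_subset_singleton x c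
      (fun t ht ↦ le_antisymm (not_lt.1 (key c hc t ht)) (not_lt.1 (key t ht c hc))) hx⟩

/-- The commutant of a prime C*-algebra in its local multiplier algebra is trivial. -/
theorem exists_eq_algebraMap (hA : IsPrimeCStar A) {x : Mloc A}
    (h : ∀ a, Commute x (coe A a)) : ∃ c : ℂ, x = algebraMap ℂ (Mloc A) c := by
  have hs : ∀ a, Commute (star x) (coe A a) := fun a ↦ by
    have := (h (star a)).star_star
    rwa [← map_star, star_star] at this
  have hr : ∀ a, Commute (realPart x : Mloc A) (coe A a) := fun a ↦ by
    rw [realPart_apply_coe]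
    exact ((h a).add_left (hs a)).smul_left _
  have hi : ∀ a, Commute (imaginaryPart x : Mloc A) (coe A a) := fun a ↦ by
    rw [imaginaryPart_apply_coe]
    exact (((h a).sub_left (hs a)).smul_left _).smul_left _
  obtain ⟨s, hs⟩ := exists_eq_algebraMap_of_isSelfAdjoint hA (realPart x).2 hr
  obtain ⟨t, ht⟩ := exists_eq_algebraMap_of_isSelfAdjoint hA (imaginaryPart x).2 hi
  refine ⟨s + Complex.I * t, ?_⟩
  rw [← realPart_add_I_smul_imaginaryPart x, hs, ht]
  simp only [Algebra.algebraMap_eq_smul_one, add_smul, mul_smul, Complex.coe_smul]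

end Mloc

/-! ### Coefficients, translates and averaging in the crossed product -/

namespace CrossedProduct

variable {A : Type u} [NonUnitalCStarAlgebra A] {G : Type v} [Group G]
variable {α : G →* (A ≃⋆ₐ[ℂ] A)}

theorem norm_act (α : G →* (A ≃⋆ₐ[ℂ] A)) (g : G) (a : A) : ‖α g a‖ = ‖a‖ :=
  NonUnitalStarAlgHom.norm_map (α g) (α g).injective a

theorem act_inv_act (α : G →* (A ≃⋆ₐ[ℂ] A)) (g : G) (a : A) : α g (α g⁻¹ a) = a := by
  rw [act_act, mul_inv_cancel, one_apply]

theorem act_ne_zero (α : G →* (A ≃⋆ₐ[ℂ] A)) (g : G) {a : A} (ha : a ≠ 0) : α g a ≠ 0 := by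
  rwa [← norm_ne_zero_iff, norm_act, norm_ne_zero_iff]

open Classical in
variable (α) in
/-- The element `a δ_g` of the crossed product. -/
def single (g : G) (a : A) : CrossedProduct α := fun h ↦ if h = g then a else 0

open Classical in
theorem single_apply (g h : G) (a : A) : single α g a h = if h = g then a else 0 := rfl

@[simp] theorem single_same (g : G) (a : A) : single α g a g = a := by simp [single_apply]

theorem single_of_ne {g h : G} (hg : h ≠ g) (a : A) : single α g a h = 0 := by
  simp [single_apply, hg]

/-- Right multiplication by the canonical unitary `λ_g`. -/
def shift (g : G) (f : CrossedProduct α) : CrossedProduct α := fun h ↦ f (h * g⁻¹)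

@[simp] theorem shift_apply (g h : G) (f : CrossedProduct α) : shift g f h = f (h * g⁻¹) := rfl

@[simp] theorem sub_apply (f h : CrossedProduct α) (g : G) : (f - h) g = f g - h g := rfl

variable (α) in
/-- Evaluation at a group element. -/
def evalHom (g : G) : CrossedProduct α →+ A where
  toFun f := f g
  map_zero' := rfl
  map_add' _ _ := rfl

@[simp] theorem sum_apply {ι : Type*} (s : Finset ι) (F : ι → CrossedProduct α) (g : G) :
    (∑ i ∈ s, F i) g = ∑ i ∈ s, F i g := map_sum (evalHom α g) F s

variable [Fintype G]

theorem embed_eq_single (a : A) : embed α a = single α 1 a := rfl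

theorem mul_embed_apply (f : CrossedProduct α) (a : A) (g : G) :
    (f * embed α a) g = f g * α g a := by
  rw [mul_apply, Finset.sum_eq_single g (fun p _ hp ↦ ?_) (by simp), inv_mul_cancel,
    embed_eq_single, single_same]
  rw [embed_eq_single, single_of_ne (by rwa [Ne, inv_mul_eq_one]), map_zero, mul_zero]

theorem embed_mul_apply (f : CrossedProduct α) (a : A) (g : G) :
    (embed α a * f) g = a * f g := by
  rw [mul_apply, Finset.sum_eq_single 1 (fun p _ hp ↦ ?_) (by simp), inv_one, one_mul,
    one_apply, embed_eq_single, single_same]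
  rw [embed_eq_single, single_of_ne hp, zero_mul]

theorem mul_shift (f h : CrossedProduct α) (g : G) : f * shift g h = shift g (f * h) := by
  ext q
  simp [mul_apply, mul_assoc]

theorem sum_single (f : CrossedProduct α) : ∑ g, single α g (f g) = f := by
  ext h
  rw [sum_apply]
  exact (Finset.sum_eq_single h (fun p _ hp ↦ single_of_ne hp.symm _) (by simp)).trans
    (single_same _ _)

theorem embed_mul_single (a b : A) (g : G) : embed α a * single α g b = single α g (a * b) := by
  ext h
  rw [embed_mul_apply, single_apply, single_apply]
  split_ifs <;> simp

theorem single_mul_embed (a b : A) (g : G) :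
    single α g a * embed α b = single α g (a * α g b) := by
  ext h
  rw [mul_embed_apply, single_apply, single_apply]
  split_ifs with hg
  · rw [hg]
  · simp

theorem single_add (g : G) (a b : A) : single α g (a + b) = single α g a + single α g b := by
  ext h
  simp only [add_apply, single_apply]
  split_ifs <;> simp

theorem single_neg (g : G) (a : A) : single α g (-a) = -single α g a := by
  rw [eq_neg_iff_add_eq_zero, ← single_add, neg_add_cancel]
  ext h
  simp [single_apply]

theorem single_zero (g : G) : single α g 0 = 0 := by
  ext h
  simp [single_apply]

section Order

attribute [local instance] CStarAlgebra.spectralOrder CStarAlgebra.spectralOrderedRing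

/-- Up to an automorphism, f(g) is the (g, e) entry of the regular representation. Together with
`norm_le_sum` this makes the C*-norm equivalent to the ℓ¹-norm of the coefficients. -/
theorem norm_apply_le (f : CrossedProduct α) (g : G) : ‖f g‖ ≤ ‖f‖ := by
  have h := CStarMatrix.norm_entry_le_norm (M := regRep f) (i := g) (j := 1)
  rwa [regRep_apply, norm_act, inv_one, mul_one, ← norm_def] at h

end Order

theorem norm_embed_le (a : A) : ‖embed α a‖ ≤ ‖a‖ :=
  NonUnitalStarAlgHom.norm_apply_le (embed α) a

/-- The C*-identity reduces this to g = e, because (a δ_g)(a δ_g)* = a a* δ_e. -/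
theorem norm_single_le (g : G) (a : A) : ‖single α g a‖ ≤ ‖a‖ := by
  have h : single α g a * star (single α g a) = embed α (a * star a) := by
    ext h
    rw [mul_apply, Finset.sum_eq_single g (fun p _ hp ↦ by rw [single_of_ne hp, zero_mul]) (by simp),
      single_same, star_apply, act_act, mul_inv_cancel_left, embed_eq_single]
    by_cases h1 : h = 1
    · subst h1
      simp
    · rw [single_of_ne h1, single_of_ne (fun h2 ↦ h1 ?_)]
      · simp
      · simpa using h2
  have h2 := norm_embed_le (α := α) (a * star a)
  rw [← h, CStarRing.norm_self_mul_star, CStarRing.norm_self_mul_star] at h2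
  exact le_of_sq_le_sq (by rwa [sq, sq]) (norm_nonneg _)

theorem norm_le_sum (f : CrossedProduct α) : ‖f‖ ≤ ∑ g, ‖f g‖ := by
  conv_lhs => rw [← sum_single f]
  exact (norm_sum_le _ _).trans (Finset.sum_le_sum fun g _ ↦ norm_single_le g _)

theorem continuous_apply' (g : G) : Continuous fun f : CrossedProduct α ↦ f g :=
  AddMonoidHomClass.continuous_of_bound (evalHom α g) 1 fun f ↦ by
    rw [one_mul]
    exact norm_apply_le f g

theorem norm_shift_le (g : G) (f : CrossedProduct α) : ‖shift g f‖ ≤ Fintype.card G * ‖f‖ := by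
  refine (norm_le_sum _).trans ((Finset.sum_le_card_nsmul _ _ ‖f‖ fun h _ ↦ ?_).trans_eq ?_)
  · exact norm_apply_le f _
  · rw [nsmul_eq_mul, Finset.card_univ]

theorem continuous_shift (g : G) : Continuous (shift g : CrossedProduct α → CrossedProduct α) :=
  AddMonoidHomClass.continuous_of_bound
    ({ toFun := shift g, map_zero' := rfl, map_add' := fun _ _ ↦ rfl } :
      CrossedProduct α →+ CrossedProduct α) (Fintype.card G) (norm_shift_le g)

theorem continuous_single (g : G) : Continuous (single α g) :=
  AddMonoidHomClass.continuous_of_bound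
    ({ toFun := single α g, map_zero' := single_zero g, map_add' := single_add g } :
      A →+ CrossedProduct α) 1 fun a ↦ by
    rw [one_mul]
    exact norm_single_le g a

/-- For nonunital A the unitary λ_g is only a multiplier of the crossed product. An approximate unit
(e) repairs this: f λ_g is the limit of f (e λ_g). -/
theorem shift_mem {I : TwoSidedIdeal (CrossedProduct α)}
    (hI : IsClosed (I : Set (CrossedProduct α))) (g : G) {f : CrossedProduct α} (hf : f ∈ I) :
    shift g f ∈ I := by
  obtain ⟨l, _, -, -, h⟩ := exists_approxUnit (CrossedProduct α)
  refine hI.mem_of_tendsto (((continuous_shift g).tendsto f).comp (h f))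
    (Eventually.of_forall fun e ↦ ?_)
  rw [Function.comp_apply, ← mul_shift]
  exact I.mul_mem_right _ _ hf

/-- Suppose that `I` contains no nonzero element supported in `S`. If each translate `x λ_h` agrees
outside `S` with an element of `I`, then `x ∈ I`: this is the averaging argument of Maschke's
theorem. -/
theorem mem_of_shift_sub_mem {I : TwoSidedIdeal (CrossedProduct α)}
    (hI : IsClosed (I : Set (CrossedProduct α))) (hess : IsEssential I) (S : Set G)
    (hS : ∀ f ∈ I, (∀ g, g ∉ S → f g = 0) → f = 0) {x : CrossedProduct α}
    (i : G → CrossedProduct α) (hi : ∀ h, i h ∈ I)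
    (hx : ∀ h g, g ∉ S → (shift h x - i h) g = 0) : x ∈ I := by
  -- The element z = ∑ i_h λ_h⁻¹ of I plays the role of |G| x: each i_h approximates x λ_h modulo
  -- functions supported in S.
  set z := ∑ h, shift h⁻¹ (i h) with hz
  have hzI : z ∈ I := sum_mem fun h _ ↦ shift_mem hI _ (hi h)
  -- Expand x y λ_h = ∑_k x λ_{kh} α_{(kh)⁻¹}(y(k)) and replace x λ_{kh} by i_{kh}. The difference
  -- lies in I and is supported in S, hence vanishes.
  have key : ∀ y ∈ I, ∀ h, shift h (x * y) =
      ∑ k, i (k * h) * embed α (α (k * h)⁻¹ (y k)) := fun y hy h ↦ by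
    rw [← sub_eq_zero]
    refine hS _ (I.sub_mem (shift_mem hI _ (I.mul_mem_left _ _ hy))
      (sum_mem fun k _ ↦ I.mul_mem_right _ _ (hi _))) fun q hq ↦ ?_
    have e : shift h (x * y) q =
        ∑ k, (shift (k * h) x * embed α (α (k * h)⁻¹ (y k))) q := by
      rw [shift_apply, mul_apply]
      refine Fintype.sum_equiv ((Equiv.inv G).trans (Equiv.mulRight (q * h⁻¹))) _ _ fun p ↦ ?_
      rw [mul_embed_apply, act_act, shift_apply]
      simp [mul_assoc]
    rw [sub_apply, e, sum_apply, ← Finset.sum_sub_distrib]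
    refine Finset.sum_eq_zero fun k _ ↦ ?_
    rw [← sub_apply, ← sub_mul, mul_embed_apply, hx _ _ hq, zero_mul]
  have hn : ((Fintype.card G : ℕ) : ℂ) ≠ 0 := Nat.cast_ne_zero.2 Fintype.card_ne_zero
  have hzx : ∀ y ∈ I, ((Fintype.card G : ℂ) • x - z) * y = 0 := fun y hy ↦ by
    rw [sub_mul, sub_eq_zero, smul_mul_assoc]
    ext q
    -- Evaluating the identity at q h gives one formula for (x y)(q) for each h; their sum over h is
    -- |G| (x y)(q) = (z y)(q).
    have e : ∀ h, (x * y) q = ∑ k, (i (k * h)) (q * h) * α (q * h) (α (k * h)⁻¹ (y k)) := by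
      intro h
      have := congrArg (fun f : CrossedProduct α ↦ f (q * h)) (key y hy h)
      simpa [mul_embed_apply] using this
    have e1 : ((Fintype.card G : ℂ) • (x * y)) q = ∑ _h : G, (x * y) q := by
      rw [smul_apply, Finset.sum_const, Finset.card_univ, Nat.cast_smul_eq_nsmul]
    rw [e1, Finset.sum_congr rfl fun h _ ↦ e h, Finset.sum_comm, mul_apply]
    refine Fintype.sum_equiv ((Equiv.inv G).trans (Equiv.mulLeft q)) _ _ fun k ↦ ?_
    rw [hz, sum_apply, Finset.sum_mul]
    refine Fintype.sum_equiv (Equiv.mulLeft k) _ _ fun h ↦ ?_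
    rw [act_act]
    simp [mul_assoc]
  have hxz : (Fintype.card G : ℂ) • x = z := by
    rw [← sub_eq_zero]
    exact hess _ hzx
  rw [← inv_smul_smul₀ hn x, hxz]
  exact smul_mem_of_isClosed hI _ hzI

end CrossedProduct

/-! ### Cofinality of the invariant ideals J and of the ideals J ⋊ G -/

section InvariantIdeals

variable {A : Type u} [NonUnitalCStarAlgebra A] {G : Type v} [Group G]

/-- The `α`-invariant closed essential ideals of `A`. -/
structure InvIdeal (α : G →* (A ≃⋆ₐ[ℂ] A)) where
  /-- the underlying essential ideal -/
  ess : EssIdeal A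
  act_mem : ∀ (g : G) {a : A}, a ∈ ess.ideal → α g a ∈ ess.ideal

namespace InvIdeal

open CrossedProduct

variable {α : G →* (A ≃⋆ₐ[ℂ] A)}

/-- The largest invariant subset of the preimage of an ideal of `A`. -/
def core (α : G →* (A ≃⋆ₐ[ℂ] A)) (I : TwoSidedIdeal A) : TwoSidedIdeal A :=
  TwoSidedIdeal.mk' {a | ∀ g, α g a ∈ I} (fun g ↦ by simp [I.zero_mem])
    (fun hx hy g ↦ by rw [map_add]; exact I.add_mem (hx g) (hy g))
    (fun hx g ↦ by rw [map_neg]; exact I.neg_mem (hx g))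
    (fun hy g ↦ by rw [map_mul]; exact I.mul_mem_left _ _ (hy g))
    (fun hx g ↦ by rw [map_mul]; exact I.mul_mem_right _ _ (hx g))

theorem mem_core {I : TwoSidedIdeal A} {a : A} : a ∈ core α I ↔ ∀ g, α g a ∈ I :=
  TwoSidedIdeal.mem_mk' _ _ _ _ _ _ a

theorem isClosed_core {I : TwoSidedIdeal A} (hI : IsClosed (I : Set A)) :
    IsClosed (core α I : Set A) := by
  have : (core α I : Set A) = ⋂ g, α g ⁻¹' (I : Set A) := by
    ext a
    simp [mem_core]
  rw [this]
  exact isClosed_iInter fun g ↦ hI.preimage (continuous_action α g)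

/-- The invariant essential ideal defined by a closed ideal containing a nonzero orbit. -/
def ofOrbit (hA : IsPrimeCStar A) (I : TwoSidedIdeal A) (hI : IsClosed (I : Set A)) {a : A}
    (ha : a ≠ 0) (h : ∀ g, α g a ∈ I) : InvIdeal α where
  ess :=
    { ideal := core α I
      isClosed := isClosed_core hI
      essential := hA _ (isClosed_core hI) fun h0 ↦ ha <| by
        have : a ∈ core α I := mem_core.2 h
        rwa [h0, TwoSidedIdeal.mem_bot] at this }
  act_mem g a ha := mem_core.2 fun k ↦ by
    rw [act_act]
    exact mem_core.1 ha _

theorem ofOrbit_le (hA : IsPrimeCStar A) (I : TwoSidedIdeal A) (hI : IsClosed (I : Set A)) {a : A}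
    (ha : a ≠ 0) (h : ∀ g, α g a ∈ I) : (ofOrbit hA I hI ha h).ess.ideal ≤ I := fun b hb ↦ by
  simpa [one_apply] using mem_core.1 hb 1

/-- Invariant essential ideals are cofinal among essential ideals. -/
theorem exists_le [Finite G] [Nontrivial A] (hA : IsPrimeCStar A) (I : EssIdeal A) :
    ∃ J : InvIdeal α, I ≤ J.ess := by
  obtain ⟨b, hb, hb0⟩ : ∃ b ∈ I.ideal, b ≠ 0 := by
    by_contra! h
    obtain ⟨a, ha⟩ := exists_ne (0 : A)
    exact ha (I.essential a fun x hx ↦ by rw [h x hx, mul_zero])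
  -- The finitely many translates of I are nonzero ideals, so they share a nonzero element; its
  -- whole orbit lies in I.
  obtain ⟨a, ha, h⟩ := hA.exists_mem_forall (fun g : G ↦ I.ideal.comap (α g)) fun g ↦
    ⟨α g⁻¹ b, by
      rwa [TwoSidedIdeal.mem_comap, act_inv_act],
      act_ne_zero α _ hb0⟩
  refine ⟨ofOrbit hA I.ideal I.isClosed ha fun g ↦ ?_, ofOrbit_le hA _ _ ha _⟩
  exact (TwoSidedIdeal.mem_comap _).1 (h g)

variable [Fintype G]

/-- The ideal `J ⋊ G` of `A ⋊ G`. -/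
def crossIdeal (J : InvIdeal α) : TwoSidedIdeal (CrossedProduct α) :=
  TwoSidedIdeal.mk' {f : CrossedProduct α | ∀ g, f g ∈ J.ess.ideal}
    (fun _ ↦ J.ess.ideal.zero_mem)
    (fun hx hy g ↦ J.ess.ideal.add_mem (hx g) (hy g))
    (fun hx g ↦ J.ess.ideal.neg_mem (hx g))
    (fun hy _ ↦ sum_mem fun p _ ↦ J.ess.ideal.mul_mem_left _ _ (J.act_mem p (hy _)))
    (fun hx _ ↦ sum_mem fun p _ ↦ J.ess.ideal.mul_mem_right _ _ (hx p))

theorem mem_crossIdeal {J : InvIdeal α} {f : CrossedProduct α} :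
    f ∈ J.crossIdeal ↔ ∀ g, f g ∈ J.ess.ideal :=
  TwoSidedIdeal.mem_mk' _ _ _ _ _ _ f

theorem embed_mem_crossIdeal {J : InvIdeal α} {a : A} (ha : a ∈ J.ess.ideal) :
    embed α a ∈ J.crossIdeal := mem_crossIdeal.2 fun g ↦ by
  rw [embed_eq_single, single_apply]
  split_ifs
  · exact ha
  · exact J.ess.ideal.zero_mem

/-- The essential ideal `J ⋊ G` of `A ⋊ G`. -/
def cross (J : InvIdeal α) : EssIdeal (CrossedProduct α) where
  ideal := J.crossIdeal
  isClosed := by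
    have : (J.crossIdeal : Set (CrossedProduct α)) =
        ⋂ g, (fun f : CrossedProduct α ↦ f g) ⁻¹' (J.ess.ideal : Set A) := by
      ext f
      simp [mem_crossIdeal]
    rw [this]
    exact isClosed_iInter fun g ↦ J.ess.isClosed.preimage (continuous_apply' g)
  essential f h := by
    ext g
    refine J.ess.essential _ fun a ha ↦ ?_
    have := h (embed α (α g⁻¹ a)) (embed_mem_crossIdeal (J.act_mem _ ha))
    rw [← act_inv_act α g a, ← mul_embed_apply, this, CrossedProduct.zero_apply]

theorem mem_cross {J : InvIdeal α} {f : CrossedProduct α} :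
    f ∈ J.cross.ideal ↔ ∀ g, f g ∈ J.ess.ideal := mem_crossIdeal

theorem embed_mem_cross {J : InvIdeal α} {a : A} (ha : a ∈ J.ess.ideal) :
    embed α a ∈ J.cross.ideal := embed_mem_crossIdeal ha

theorem cross_le_cross {J K : InvIdeal α} : J.cross ≤ K.cross ↔ J.ess ≤ K.ess :=
  ⟨fun h a ha ↦ by
    simpa [embed_eq_single] using mem_cross.1 (h (embed_mem_cross ha)) 1,
  fun h f hf ↦ mem_cross.2 fun g ↦ h (mem_cross.1 hf g)⟩

/-- For an essential ideal `I` of `A ⋊ G` there is a nonzero `a : A` with `α_h(a) δ_g ∈ I` for all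
`g` and `h`. -/
theorem exists_single_mem [Nontrivial A] (hA : IsPrimeCStar A) (I : EssIdeal (CrossedProduct α)) :
    ∃ a : A, a ≠ 0 ∧ ∀ h g, single α g (α h a) ∈ I.ideal := by
  classical
  -- P consists of the supports S that carry no nonzero element of I. It contains ∅, and a maximal S
  -- is taken.
  let P : Set (Finset G) := {S | ∀ f ∈ I.ideal, (∀ g, g ∉ S → f g = 0) → f = 0}
  obtain ⟨S, hS, hmax⟩ : ∃ S, Maximal (· ∈ P) S :=
    (Set.toFinite P).exists_maximal ⟨∅, fun f _ h ↦ CrossedProduct.ext fun g ↦ h g (by simp)⟩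
  -- K g collects the a for which a δ_g agrees with an element of I outside S. This is the
  -- hypothesis of `mem_of_shift_sub_mem`.
  let K : G → TwoSidedIdeal A := fun g ↦
    TwoSidedIdeal.mk' {a | ∃ i ∈ I.ideal, ∀ q, q ∉ S → (single α g a - i) q = 0}
      ⟨0, I.ideal.zero_mem, by simp [single_zero]⟩
      (by
        rintro x y ⟨i, hi, h⟩ ⟨j, hj, h'⟩
        refine ⟨i + j, I.ideal.add_mem hi hj, fun q hq ↦ ?_⟩
        rw [single_add, add_sub_add_comm, CrossedProduct.add_apply, h q hq, h' q hq, add_zero])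
      (by
        rintro x ⟨i, hi, h⟩
        refine ⟨-i, I.ideal.neg_mem hi, fun q hq ↦ ?_⟩
        have := h q hq
        rw [CrossedProduct.sub_apply, sub_eq_zero] at this
        rw [single_neg, sub_neg_eq_add, neg_add_eq_sub, CrossedProduct.sub_apply, this, sub_self])
      (by
        rintro x y ⟨i, hi, h⟩
        refine ⟨embed α x * i, I.ideal.mul_mem_left _ _ hi, fun q hq ↦ ?_⟩
        rw [← embed_mul_single, ← mul_sub, embed_mul_apply, h q hq, mul_zero])
      (by
        rintro x y ⟨i, hi, h⟩
        refine ⟨i * embed α (α g⁻¹ y), I.ideal.mul_mem_right _ _ hi, fun q hq ↦ ?_⟩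
        have : single α g (x * y) = single α g x * embed α (α g⁻¹ y) := by
          rw [single_mul_embed, act_inv_act]
        rw [this, ← sub_mul, mul_embed_apply, h q hq, zero_mul])
  have hK : ∀ g a, a ∈ K g ↔ ∃ i ∈ I.ideal, ∀ q, q ∉ S → (single α g a - i) q = 0 :=
    fun g a ↦ TwoSidedIdeal.mem_mk' _ _ _ _ _ _ a
  have hK0 : ∀ g, ∃ a ∈ K g, a ≠ 0 := fun g ↦ by
    by_cases hg : g ∈ S
    · obtain ⟨a, ha⟩ := exists_ne (0 : A)
      refine ⟨a, (hK g a).2 ⟨0, I.ideal.zero_mem, fun q hq ↦ ?_⟩, ha⟩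
      rw [sub_zero, single_of_ne]
      rintro rfl
      exact hq hg
    -- By maximality some nonzero f in I is supported in S ∪ {g}. Its coefficient f(g) lies in K g,
    -- and it is nonzero since otherwise f would be supported in S.
    · have hn : insert g S ∉ P := fun h ↦
        hg (hmax h (Finset.subset_insert g S) (Finset.mem_insert_self g S))
      have hn' : ¬ ∀ f ∈ I.ideal, (∀ q, q ∉ insert g S → f q = 0) → f = 0 := hn
      push Not at hn'
      obtain ⟨f, hf, hfS, hf0⟩ := hn'
      refine ⟨f g, (hK g _).2 ⟨f, hf, fun q hq ↦ ?_⟩, fun h0 ↦ hf0 (hS f hf fun q hq ↦ ?_)⟩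
      · by_cases hqg : q = g
        · subst hqg
          rw [CrossedProduct.sub_apply, single_same, sub_self]
        · rw [CrossedProduct.sub_apply, single_of_ne hqg, hfS q (by simp [hqg, hq]), sub_self]
      · by_cases hqg : q = g
        · rwa [hqg]
        · exact hfS q (by simp [hqg, hq])
  obtain ⟨a, ha, haK⟩ := hA.exists_mem_forall (fun p : G × G ↦ (K p.1).comap (α p.2)) fun p ↦ by
    obtain ⟨b, hb, hb0⟩ := hK0 p.1
    refine ⟨α p.2⁻¹ b, ?_, act_ne_zero α _ hb0⟩
    rwa [TwoSidedIdeal.mem_comap, act_inv_act]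
  refine ⟨a, ha, fun h g ↦ ?_⟩
  have hk : ∀ k, ∃ i ∈ I.ideal, ∀ q, q ∉ S → (single α (g * k) (α h a) - i) q = 0 := fun k ↦
    (hK _ _).1 ((TwoSidedIdeal.mem_comap _).1 (haK (g * k, h)))
  choose i hi hiS using hk
  -- The translate of α_h(a) δ_g by λ_k is α_h(a) δ_{gk}, and α_h(a) was chosen in K (g k) for every
  -- k.
  refine mem_of_shift_sub_mem I.isClosed I.essential S hS i hi
    fun k q hq ↦ ?_
  rw [← hiS k q (by simpa using hq), CrossedProduct.sub_apply, CrossedProduct.sub_apply,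
    shift_apply, single_apply, single_apply]
  simp only [mul_inv_eq_iff_eq_mul]

/-- The ideals `J ⋊ G` are cofinal among the essential ideals of `A ⋊ G`. -/
theorem exists_le_cross [Nontrivial A] (hA : IsPrimeCStar A) (I : EssIdeal (CrossedProduct α)) :
    ∃ J : InvIdeal α, I ≤ J.cross := by
  obtain ⟨a, ha, h⟩ := exists_single_mem hA I
  let L : TwoSidedIdeal A := TwoSidedIdeal.mk' {a | ∀ g, single α g a ∈ I.ideal}
    (fun g ↦ by rw [single_zero]; exact I.ideal.zero_mem)
    (fun hx hy g ↦ by rw [single_add]; exact I.ideal.add_mem (hx g) (hy g))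
    (fun hx g ↦ by rw [single_neg]; exact I.ideal.neg_mem (hx g))
    (fun hy g ↦ by rw [← embed_mul_single]; exact I.ideal.mul_mem_left _ _ (hy g))
    (fun {x y} hx g ↦ by
      have : single α g (x * y) = single α g x * embed α (α g⁻¹ y) := by
        rw [single_mul_embed, act_inv_act]
      rw [this]
      exact I.ideal.mul_mem_right _ _ (hx g))
  have hL : ∀ a, a ∈ L ↔ ∀ g, single α g a ∈ I.ideal :=
    fun a ↦ TwoSidedIdeal.mem_mk' _ _ _ _ _ _ a
  have hLc : IsClosed (L : Set A) := by
    have : (L : Set A) = ⋂ g, single α g ⁻¹' (I.ideal : Set (CrossedProduct α)) := by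
      ext a
      simp [hL]
    rw [this]
    exact isClosed_iInter fun g ↦ I.isClosed.preimage (continuous_single g)
  refine ⟨ofOrbit hA L hLc ha fun k ↦ (hL _).2 fun g ↦ h k g, fun f hf ↦ ?_⟩
  rw [← sum_single f]
  exact sum_mem fun g _ ↦ (hL _).1 (ofOrbit_le hA L hLc ha _ (mem_cross.1 hf g)) g

end InvIdeal

end InvariantIdeals

/-! ### Constructing double centralizers -/

section DoubleCentralizers

variable {A : Type u} [NonUnitalCStarAlgebra A]

theorem eq_of_forall_mul_left_eq {a b : A} (h : ∀ x, x * a = x * b) : a = b := by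
  rw [← sub_eq_zero]
  refine (CStarRing.star_mul_self_eq_zero_iff _).1 ?_
  rw [mul_sub, h, sub_self]

theorem eq_of_forall_mul_right_eq {a b : A} (h : ∀ x, a * x = b * x) : a = b := by
  rw [← sub_eq_zero]
  refine (CStarRing.mul_star_self_eq_zero_iff _).1 ?_
  rw [sub_mul, h, sub_self]

/-- A pair of maps satisfying the centrality condition, the first of which is bounded, is a double
centralizer. -/
def mkCentralizer (L R : A → A) (h : ∀ x y, R x * y = x * L y) (C : ℝ)
    (hL : ∀ x, ‖L x‖ ≤ C * ‖x‖) : 𝓜(ℂ, A) where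
  fst := LinearMap.mkContinuous
    { toFun := L
      map_add' := fun x y ↦ eq_of_forall_mul_left_eq fun z ↦ by
        rw [← h, mul_add, mul_add, h, h]
      map_smul' := fun c x ↦ eq_of_forall_mul_left_eq fun z ↦ by
        rw [← h, RingHom.id_apply, mul_smul_comm, mul_smul_comm, h] } C hL
  snd := LinearMap.mkContinuous
    { toFun := R
      map_add' := fun x y ↦ eq_of_forall_mul_right_eq fun z ↦ by
        rw [h, add_mul, add_mul, h, h]
      map_smul' := fun c x ↦ eq_of_forall_mul_right_eq fun z ↦ by
        rw [h, RingHom.id_apply, smul_mul_assoc, smul_mul_assoc, h] } C fun x ↦ by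
      -- The bound on L passes to R by ‖R x‖² = ‖R x (R x)*‖ = ‖x L((R x)*)‖ ≤ C ‖x‖ ‖R x‖.
      change ‖R x‖ ≤ C * ‖x‖
      by_cases h0 : ‖R x‖ = 0
      · rw [h0]
        by_cases hx : x = 0
        · simp [hx]
        · have := (norm_nonneg _).trans (hL x)
          exact this
      · refine le_of_mul_le_mul_right ?_ (lt_of_le_of_ne (norm_nonneg (R x)) (Ne.symm h0))
        calc ‖R x‖ * ‖R x‖ = ‖x * L (star (R x))‖ := by
              rw [← CStarRing.norm_self_mul_star, h]
          _ ≤ ‖x‖ * (C * ‖star (R x)‖) :=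
              (norm_mul_le _ _).trans (mul_le_mul_of_nonneg_left (hL _) (norm_nonneg _))
          _ = C * ‖x‖ * ‖R x‖ := by rw [norm_star]; ring
  central := h

theorem norm_mkCentralizer_le (L R : A → A) (h : ∀ x y, R x * y = x * L y) {C : ℝ} (hC : 0 ≤ C)
    (hL : ∀ x, ‖L x‖ ≤ C * ‖x‖) : ‖mkCentralizer L R h C hL‖ ≤ C := by
  rw [← DoubleCentralizer.norm_fst]
  exact ContinuousLinearMap.opNorm_le_bound _ hC hL

end DoubleCentralizers

/-! ### Extending maps from a cofinal family of ideals -/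

namespace Mloc

variable {A : Type u} [NonUnitalCStarAlgebra A]

/-- A uniformly bounded compatible family of linear maps on the multiplier algebras of a cofinal
family of essential ideals extends to the local multiplier algebra. -/
theorem exists_extension {ι : Type*} (i : ι → EssIdeal A) (hi : ∀ I, ∃ a, I ≤ i a)
    {Y : Type*} [NormedAddCommGroup Y] [NormedSpace ℂ Y] [CompleteSpace Y]
    (T : ∀ a, 𝓜(ℂ, (i a).toSub) →ₗ[ℂ] Y) (C : ℝ) (hC : ∀ a m, ‖T a m‖ ≤ C * ‖m‖)
    (hT : ∀ a b (h : i a ≤ i b) m, T b (restrict h m) = T a m) :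
    ∃ F : Mloc A →L[ℂ] Y, ∀ a m, F (of (i a) m) = T a m := by
  choose a ha using hi
  -- The value does not depend on the chosen member of the family: any two are compared on a common
  -- smaller member.
  have hT' : ∀ {I b c} (hb : I ≤ i b) (hc : I ≤ i c) m,
      T b (restrict hb m) = T c (restrict hc m) := fun {I b c} hb hc m ↦ by
    obtain ⟨d, hbd, hcd⟩ := exists_ge_ge (i b) (i c)
    rw [← hT b (a d) (hbd.trans (ha d)), ← hT c (a d) (hcd.trans (ha d))]
    rfl
  let F₀ : PreMloc A → Y := DirectLimit.lift (fun (I J : EssIdeal A) (h : I ≤ J) ↦ restrict h)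
    (fun I m ↦ T (a I) (restrict (ha I) m)) fun I J h m ↦
      hT' (ha I) (h.trans (ha J)) m
  have hF₀ : ∀ I m, F₀ (PreMloc.of I m) = T (a I) (restrict (ha I) m) := fun I m ↦ rfl
  let F₁ : PreMloc A →ₗ[ℂ] Y :=
    { toFun := F₀
      map_add' := fun x y ↦ by
        obtain ⟨I, m, n, rfl, rfl⟩ := PreMloc.exists_of₂ x y
        rw [← map_add, hF₀, hF₀, hF₀, map_add, map_add]
      map_smul' := fun c x ↦ by
        obtain ⟨I, m, rfl⟩ := PreMloc.exists_of x
        rw [← map_smul, hF₀, hF₀, map_smul, map_smul, RingHom.id_apply] }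
  let e : PreMloc A →ₗ[ℂ] Mloc A :=
    { toFun := ofPre
      map_add' := ofPre_add
      map_smul' := ofPre_smul }
  have he : DenseRange e := UniformSpace.Completion.denseRange_coe
  have hb : ∀ x, ‖F₁ x‖ ≤ C * ‖e x‖ := fun x ↦ by
    obtain ⟨I, m, rfl⟩ := PreMloc.exists_of x
    refine (hC _ _).trans_eq ?_
    rw [norm_restrict]
    exact congrArg (C * ·) (norm_ofPre (PreMloc.of I m)).symm
  refine ⟨F₁.extendOfNorm e, fun b m ↦ ?_⟩
  refine (LinearMap.extendOfNorm_eq he ⟨C, hb⟩ (PreMloc.of (i b) m)).trans ?_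
  exact (hT' (ha (i b)) le_rfl m)

theorem induction_of {ι : Type*} (i : ι → EssIdeal A) (hi : ∀ I, ∃ a, I ≤ i a)
    {p : Mloc A → Prop} (x : Mloc A) (hp : IsClosed {x | p x}) (h : ∀ a m, p (of (i a) m)) :
    p x := by
  refine induction x hp fun y ↦ ?_
  obtain ⟨I, m, rfl⟩ := PreMloc.exists_of y
  obtain ⟨a, ha⟩ := hi I
  have := h a (restrict ha m)
  rwa [of_restrict] at this

end Mloc

/-! ### Fourier coefficients of multipliers of J ⋊ G -/

namespace InvIdeal

open CrossedProduct

variable {A : Type u} [NonUnitalCStarAlgebra A] {G : Type v} [Group G]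
variable {α : G →* (A ≃⋆ₐ[ℂ] A)}

/-- The action of `G` on an invariant ideal. -/
def act (J : InvIdeal α) (g : G) (a : J.ess.toSub) : J.ess.toSub := ⟨α g a, J.act_mem g a.2⟩

theorem norm_act (J : InvIdeal α) (g : G) (a : J.ess.toSub) : ‖J.act g a‖ = ‖a‖ :=
  CrossedProduct.norm_act α g (a : A)

variable [Fintype G]

/-- The inclusion of `J` into `J ⋊ G`. -/
def emb (J : InvIdeal α) (a : J.ess.toSub) : J.cross.toSub := ⟨embed α (a : A), embed_mem_cross a.2⟩

/-- The coefficients of an element of `J ⋊ G`. -/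
def coeff (J : InvIdeal α) (g : G) (f : J.cross.toSub) : J.ess.toSub :=
  ⟨(f : CrossedProduct α) g, mem_cross.1 f.2 g⟩

theorem coeff_one_emb (J : InvIdeal α) (a : J.ess.toSub) : J.coeff 1 (J.emb a) = a :=
  Subtype.ext (single_same (α := α) 1 (a : A))

theorem coeff_emb_of_ne (J : InvIdeal α) {g : G} (hg : g ≠ 1) (a : J.ess.toSub) :
    J.coeff g (J.emb a) = 0 :=
  Subtype.ext (single_of_ne (α := α) hg (a : A))

/-- The coefficient of a multiplier of `J ⋊ G`: if `m = ∑ g, m_g λ_g` then `component g m = m_g`. -/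
def component (J : InvIdeal α) (g : G) (m : 𝓜(ℂ, J.cross.toSub)) : 𝓜(ℂ, J.ess.toSub) :=
  -- The twist by g⁻¹ compensates λ_g b = α_g(b) λ_g, so the g-coefficient of m α_{g⁻¹}(a) is m_g a.
  -- On the other side a m has g-coefficient a m_g, with no twist.
  mkCentralizer (fun a ↦ J.coeff g (m.fst (J.emb (J.act g⁻¹ a))))
    (fun a ↦ J.coeff g (m.snd (J.emb a)))
    (fun x y ↦ Subtype.ext <| by
      have h := congrArg (fun f : J.cross.toSub ↦ (f : CrossedProduct α) g)
        (m.central (J.emb x) (J.emb (J.act g⁻¹ y)))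
      have h1 : ((m.snd (J.emb x) : CrossedProduct α) * embed α (α g⁻¹ (y : A))) g =
        (embed α (x : A) * (m.fst (J.emb (J.act g⁻¹ y)) : CrossedProduct α)) g := h
      rwa [mul_embed_apply, embed_mul_apply, act_inv_act] at h1)
    ‖m‖ fun a ↦ by
      have h1 : ‖J.coeff g (m.fst (J.emb (J.act g⁻¹ a)))‖ ≤ ‖m.fst (J.emb (J.act g⁻¹ a))‖ :=
        norm_apply_le _ g
      have h2 : ‖J.emb (J.act g⁻¹ a)‖ ≤ ‖J.act g⁻¹ a‖ := norm_embed_le _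
      rw [norm_act] at h2
      refine h1.trans ((m.fst.le_opNorm _).trans ?_)
      rw [DoubleCentralizer.norm_fst]
      gcongr

theorem component_snd (J : InvIdeal α) (g : G) (m : 𝓜(ℂ, J.cross.toSub)) (a : J.ess.toSub) :
    ((J.component g m).snd a : A) = (m.snd (J.emb a) : CrossedProduct α) g := rfl

theorem norm_component_le (J : InvIdeal α) (g : G) (m : 𝓜(ℂ, J.cross.toSub)) :
    ‖J.component g m‖ ≤ ‖m‖ := norm_mkCentralizer_le _ _ _ (norm_nonneg _) _

/-- The component maps as linear maps. -/
def componentₗ (J : InvIdeal α) (g : G) : 𝓜(ℂ, J.cross.toSub) →ₗ[ℂ] 𝓜(ℂ, J.ess.toSub) where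
  toFun := J.component g
  map_add' _ _ := ext_snd fun _ ↦ rfl
  map_smul' _ _ := ext_snd fun _ ↦ rfl

theorem component_restrict {J K : InvIdeal α} (h : J.cross ≤ K.cross) (g : G)
    (m : 𝓜(ℂ, J.cross.toSub)) :
    K.component g (restrict h m) = restrict (cross_le_cross.1 h) (J.component g m) :=
  ext_snd fun _ ↦ rfl

/-- A multiplier of `J ⋊ G` is determined by its components. -/
theorem ext_component (J : InvIdeal α) {m n : 𝓜(ℂ, J.cross.toSub)}
    (h : ∀ g, J.component g m = J.component g n) : m = n := by
  have h1 : ∀ a : J.ess.toSub, m.snd (J.emb a) = n.snd (J.emb a) := fun a ↦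
    Subtype.ext <| CrossedProduct.ext fun g ↦ by
      rw [← component_snd, ← component_snd, h]
  refine ext_fst fun f ↦ Subtype.ext <| CrossedProduct.ext fun g ↦ ?_
  refine congrArg Subtype.val (a₁ := J.coeff g (m.fst f)) (a₂ := J.coeff g (n.fst f)) ?_
  -- The components determine m only on the copy of J. For general f, centrality gives a (m f) = (a
  -- m) f, and the coefficients of m f are recovered by letting a range over J.
  refine eq_of_forall_mul_left_eq fun a ↦ Subtype.ext ?_
  have h2 : J.emb a * m.fst f = J.emb a * n.fst f := by
    rw [← m.central, ← n.central, h1]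
  have h3 := congrArg (fun f : J.cross.toSub ↦ (f : CrossedProduct α) g) h2
  change (embed α (a : A) * (m.fst f : CrossedProduct α)) g =
    (embed α (a : A) * (n.fst f : CrossedProduct α)) g at h3
  rwa [embed_mul_apply, embed_mul_apply] at h3

theorem component_one_self (J : InvIdeal α) : J.component 1 1 = 1 :=
  ext_snd fun a ↦ Subtype.ext <| single_same (α := α) 1 (a : A)

theorem component_one_of_ne (J : InvIdeal α) {g : G} (hg : g ≠ 1) : J.component g 1 = 0 :=
  ext_snd fun a ↦ Subtype.ext <| single_of_ne (α := α) hg (a : A)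

theorem component_mult_mul (J : InvIdeal α) (g : G) (a : A) (m : 𝓜(ℂ, J.cross.toSub)) :
    J.component g (Mloc.mult J.cross (embed α a) * m) = Mloc.mult J.ess a * J.component g m :=
  ext_snd fun x ↦ Subtype.ext <| by
    have : (⟨embed α (x : A) * embed α a, J.cross.ideal.mul_mem_right _ _ (J.emb x).2⟩ :
        J.cross.toSub) = J.emb ⟨(x : A) * a, J.ess.ideal.mul_mem_right _ _ x.2⟩ :=
      Subtype.ext (map_mul (embed α) _ _).symm
    exact congrArg (fun y : J.cross.toSub ↦ (m.snd y : CrossedProduct α) g) this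

theorem component_mul_mult (J : InvIdeal α) (g : G) (a : A) (m : 𝓜(ℂ, J.cross.toSub)) :
    J.component g (m * Mloc.mult J.cross (embed α a)) =
      J.component g m * Mloc.mult J.ess (α g a) :=
  ext_snd fun x ↦ Subtype.ext <| mul_embed_apply (m.snd (J.emb x) : CrossedProduct α) a g

/-- The multiplier `n λ_g` of `J ⋊ G` defined by a multiplier `n` of `J`. -/
def insert (J : InvIdeal α) (g : G) (n : 𝓜(ℂ, J.ess.toSub)) : 𝓜(ℂ, J.cross.toSub) :=
  mkCentralizer
    (fun f ↦ ⟨fun h ↦ (n.fst (J.act g (J.coeff (g⁻¹ * h) f)) : A),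
      mem_cross.2 fun h ↦ (n.fst (J.act g (J.coeff (g⁻¹ * h) f))).2⟩)
    -- With p = h g⁻¹, the coefficient of f n λ_g at h is f(p) α_p(n). It is written as
    -- α_p(α_{p⁻¹}(f(p)) n), which avoids extending α_p to multipliers.
    (fun f ↦ ⟨fun h ↦ (J.act (h * g⁻¹)
        (n.snd (J.act (h * g⁻¹)⁻¹ (J.coeff (h * g⁻¹) f))) : A),
      mem_cross.2 fun h ↦ (J.act (h * g⁻¹)
        (n.snd (J.act (h * g⁻¹)⁻¹ (J.coeff (h * g⁻¹) f)))).2⟩)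
    (fun x y ↦ Subtype.ext <| CrossedProduct.ext fun q ↦ by
      refine Fintype.sum_equiv (Equiv.mulRight g⁻¹) _ _ fun p ↦ ?_
      have h1 := congrArg (fun a : J.ess.toSub ↦ α (p * g⁻¹) (a : A))
        (n.central (J.act (p * g⁻¹)⁻¹ (J.coeff (p * g⁻¹) x)) (J.act g (J.coeff (p⁻¹ * q) y)))
      have h2 : g⁻¹ * ((p * g⁻¹)⁻¹ * q) = p⁻¹ * q := by group
      have h3 : α p ((y : CrossedProduct α) (p⁻¹ * q)) =
          α (p * g⁻¹) (α g ((y : CrossedProduct α) (p⁻¹ * q))) := by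
        rw [act_act, inv_mul_cancel_right]
      have h4 := act_inv_act α (p * g⁻¹) ((x : CrossedProduct α) (p * g⁻¹))
      refine (congrArg (_ * ·) h3).trans (((map_mul (α (p * g⁻¹)) _ _).symm.trans h1).trans
        ((map_mul (α (p * g⁻¹)) _ _).trans (congrArg₂ (· * ·) h4 ?_)))
      change _ = α (p * g⁻¹) (n.fst (J.act g (J.coeff (g⁻¹ * ((p * g⁻¹)⁻¹ * q)) y)) : A)
      rw [h2])
    -- The constant is crude, coming from the sum of the norms of the coefficients; only a bound
    -- uniform in J is needed.
    (Fintype.card G * ‖n‖) fun f ↦ by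
      refine (norm_le_sum _).trans
        ((Finset.sum_le_card_nsmul _ _ (‖n‖ * ‖f‖) fun h _ ↦ ?_).trans_eq ?_)
      · have h1 : ‖J.coeff (g⁻¹ * h) f‖ ≤ ‖f‖ := norm_apply_le (f : CrossedProduct α) _
        refine (n.fst.le_opNorm (J.act g (J.coeff (g⁻¹ * h) f))).trans ?_
        rw [DoubleCentralizer.norm_fst, norm_act]
        gcongr
      · rw [nsmul_eq_mul, Finset.card_univ, mul_assoc]

theorem norm_insert_le (J : InvIdeal α) (g : G) (n : 𝓜(ℂ, J.ess.toSub)) :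
    ‖J.insert g n‖ ≤ Fintype.card G * ‖n‖ := norm_mkCentralizer_le _ _ _ (by positivity) _

/-- The map `n ↦ n λ_g` as a linear map. -/
def insertₗ (J : InvIdeal α) (g : G) : 𝓜(ℂ, J.ess.toSub) →ₗ[ℂ] 𝓜(ℂ, J.cross.toSub) where
  toFun := J.insert g
  map_add' _ _ := ext_fst fun _ ↦ rfl
  map_smul' _ _ := ext_fst fun _ ↦ rfl

theorem insert_restrict {J K : InvIdeal α} (h : J.ess ≤ K.ess) (g : G)
    (n : 𝓜(ℂ, J.ess.toSub)) :
    K.insert g (restrict h n) = restrict (cross_le_cross.2 h) (J.insert g n) :=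
  ext_fst fun _ ↦ rfl

theorem component_insert_self (J : InvIdeal α) (g : G) (n : 𝓜(ℂ, J.ess.toSub)) :
    J.component g (J.insert g n) = n :=
  ext_fst fun a ↦ by
    change n.fst (J.act g (J.coeff (g⁻¹ * g) (J.emb (J.act g⁻¹ a)))) = n.fst a
    rw [inv_mul_cancel, coeff_one_emb]
    exact congrArg n.fst (Subtype.ext (act_inv_act α g (a : A)))

theorem component_insert_of_ne (J : InvIdeal α) {g h : G} (hg : h ≠ g) (n : 𝓜(ℂ, J.ess.toSub)) :
    J.component h (J.insert g n) = 0 :=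
  ext_fst fun a ↦ by
    change n.fst (J.act g (J.coeff (g⁻¹ * h) (J.emb (J.act h⁻¹ a)))) = 0
    rw [coeff_emb_of_ne _ (by rwa [Ne, inv_mul_eq_one, eq_comm])]
    have : J.act g 0 = 0 := Subtype.ext (map_zero (α g))
    rw [this, map_zero]

end InvIdeal

/-! ### Fourier decomposition of M_loc(A ⋊ G) and intertwiners -/

section Fourier

open InvIdeal

variable {A : Type u} [NonUnitalCStarAlgebra A] {G : Type v} [Group G] [Fintype G]
variable {α : G →* (A ≃⋆ₐ[ℂ] A)}

/-- The Fourier coefficient maps `M_loc(A ⋊ G) → M_loc(A)`. -/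
theorem exists_component [Nontrivial A] (hA : IsPrimeCStar A) (g : G) :
    ∃ E : Mloc (CrossedProduct α) →L[ℂ] Mloc A, ∀ (J : InvIdeal α) m,
      E (Mloc.of J.cross m) = Mloc.of J.ess (J.component g m) :=
  Mloc.exists_extension cross (exists_le_cross hA)
    (fun J ↦ (Mloc.of J.ess).toAlgHom.toLinearMap ∘ₗ J.componentₗ g) 1
    (fun J m ↦ by
      rw [one_mul]
      exact (Mloc.norm_of _ _).trans_le (norm_component_le J g m))
    (fun J K h m ↦ (congrArg (Mloc.of K.ess) (component_restrict h g m)).trans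
      (Mloc.of_restrict _ _))

/-- The maps `M_loc(A) → M_loc(A ⋊ G)`, `x ↦ x λ_g`. -/
theorem exists_insert [Nontrivial A] (hA : IsPrimeCStar A) (g : G) :
    ∃ W : Mloc A →L[ℂ] Mloc (CrossedProduct α), ∀ (J : InvIdeal α) n,
      W (Mloc.of J.ess n) = Mloc.of J.cross (J.insert g n) :=
  Mloc.exists_extension InvIdeal.ess (exists_le hA)
    (fun J ↦ (Mloc.of J.cross).toAlgHom.toLinearMap ∘ₗ J.insertₗ g) (Fintype.card G)
    (fun _ m ↦ (Mloc.norm_of _ _).trans_le (norm_insert_le _ g m))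
    (fun _ K h m ↦ (congrArg (Mloc.of K.cross) (insert_restrict h g m)).trans
      (Mloc.of_restrict _ _))

theorem mem_centralizer_iff {x : Mloc (CrossedProduct α)} :
    x ∈ Set.centralizer (Set.range fun a : A ↦
      Mloc.coe (CrossedProduct α) (CrossedProduct.embed α a)) ↔
    ∀ a, Mloc.coe (CrossedProduct α) (CrossedProduct.embed α a) * x =
      x * Mloc.coe (CrossedProduct α) (CrossedProduct.embed α a) := by
  simp [Set.mem_centralizer_iff]

/-- If `x α_g(a) = a x` for all `a`, then `x = 0` or `α_g` is implemented by a unitary. -/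
theorem eq_zero_or_exists_unitary (hA : IsPrimeCStar A) (σ : A ≃⋆ₐ[ℂ] A) {x : Mloc A}
    (hx : ∀ a, x * Mloc.coe A (σ a) = Mloc.coe A a * x) :
    x = 0 ∨ ∃ u ∈ unitary (Mloc A), ∀ a, Mloc.coe A (σ a) = u * Mloc.coe A a * star u := by
  by_cases h0 : x = 0
  · exact .inl h0
  right
  have hx' : ∀ a, Mloc.coe A (σ a) * star x = star x * Mloc.coe A a := fun a ↦ by
    have := congrArg star (hx (star a))
    rwa [star_mul, star_mul, ← map_star, ← map_star, ← map_star, star_star] at this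
  obtain ⟨c, hc⟩ := Mloc.exists_eq_algebraMap_of_isSelfAdjoint hA (IsSelfAdjoint.mul_star_self x)
    fun a ↦ by
      rw [Commute, SemiconjBy, mul_assoc, ← hx', ← mul_assoc, hx, mul_assoc]
  obtain ⟨d, hd⟩ := Mloc.exists_eq_algebraMap_of_isSelfAdjoint hA (IsSelfAdjoint.star_mul_self x)
    fun a ↦ by
      obtain ⟨a, rfl⟩ : ∃ b, σ b = a := σ.surjective a
      rw [Commute, SemiconjBy, mul_assoc, hx, ← mul_assoc, ← hx', mul_assoc]
  have : Nontrivial (Mloc A) := ⟨x, 0, h0⟩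
  have hd0 : 0 ≤ d := by
    refine spectrum_star_mul_self_nonneg (b := x) d ?_
    rw [hd, spectrum.scalar_eq]
    exact Set.mem_singleton d
  have hdne : d ≠ 0 := by
    rintro rfl
    rw [map_zero] at hd
    exact h0 ((CStarRing.star_mul_self_eq_zero_iff x).1 hd)
  -- Both scalars act on x in the same way: (x x*) x = x (x* x).
  have hcd : c = d := by
    have h1 : c • x = d • x := by
      rw [Algebra.smul_def, Algebra.smul_def, ← hc, Algebra.commutes, ← hd, mul_assoc]
    exact smul_left_injective ℝ h0 h1
  subst hcd
  have hr : (√c)⁻¹ * (√c)⁻¹ = c⁻¹ := by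
    rw [← mul_inv, Real.mul_self_sqrt hd0]
  have hsx : star ((√c)⁻¹ • star x) = (√c)⁻¹ • x := by
    rw [star_smul, star_star, star_trivial]
  -- With u = c^(-1/2) x*, u a u* = c⁻¹ x* a x = c⁻¹ x* x σ(a) = σ(a).
  refine ⟨(√c)⁻¹ • star x, ?_, fun a ↦ ?_⟩
  · rw [Unitary.mem_iff, hsx, smul_mul_smul_comm, smul_mul_smul_comm, hr, hc, hd,
      Algebra.algebraMap_eq_smul_one, smul_smul, inv_mul_cancel₀ hdne, one_smul]
    exact ⟨rfl, rfl⟩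
  · rw [hsx, smul_mul_assoc, smul_mul_smul_comm, hr, mul_assoc, ← hx, ← mul_assoc, hd,
      Algebra.algebraMap_eq_smul_one, smul_mul_assoc, one_mul, smul_smul, inv_mul_cancel₀ hdne,
      one_smul]

/-- The Fourier decomposition of `M_loc(A ⋊ G)` over `M_loc(A)`. -/
theorem exists_fourier [Nontrivial A] (hA : IsPrimeCStar A) :
    ∃ (E : G → Mloc (CrossedProduct α) →L[ℂ] Mloc A)
      (W : G → Mloc A →L[ℂ] Mloc (CrossedProduct α)),
      (∀ g x, E g (W g x) = x) ∧ (∀ g h, h ≠ g → ∀ x, E h (W g x) = 0) ∧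
      (∀ x, ∑ g, W g (E g x) = x) ∧ E 1 1 = 1 ∧ (∀ g, g ≠ 1 → E g 1 = 0) ∧
      (∀ g x a, E g (x * Mloc.coe _ (CrossedProduct.embed α a)) =
        E g x * Mloc.coe A (α g a)) ∧
      (∀ g x a, E g (Mloc.coe _ (CrossedProduct.embed α a) * x) =
        Mloc.coe A a * E g x) := by
  choose E hE using exists_component (α := α) hA
  choose W hW using exists_insert (α := α) hA
  have h1 : ∀ g x, E g (W g x) = x := fun g x ↦ by
    refine Mloc.induction_of InvIdeal.ess (exists_le (α := α) hA)
      (p := fun x ↦ E g (W g x) = x) x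
      (isClosed_eq (by fun_prop) continuous_id) fun J n ↦ ?_
    rw [hW, hE, component_insert_self]
  have h2 : ∀ g h, h ≠ g → ∀ x, E h (W g x) = 0 := fun g h hg x ↦ by
    refine Mloc.induction_of InvIdeal.ess (exists_le (α := α) hA)
      (p := fun x ↦ E h (W g x) = 0) x
      (isClosed_eq (by fun_prop) continuous_const) fun J n ↦ ?_
    rw [hW, hE, component_insert_of_ne _ hg, map_zero]
  -- Any one J serves to compute the coefficients of the unit.
  obtain ⟨J, -⟩ := exists_le_cross (α := α) hA (EssIdeal.whole _)
  refine ⟨E, W, h1, h2, fun x ↦ ?_, ?_, fun g hg ↦ ?_, fun g x a ↦ ?_, fun g x a ↦ ?_⟩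
  · refine Mloc.induction_of cross (exists_le_cross (α := α) hA)
      (p := fun x ↦ ∑ g, W g (E g x) = x) x
      (isClosed_eq (by fun_prop) continuous_id) fun J m ↦ ?_
    simp only [hE, hW, ← map_sum]
    congr 1
    refine J.ext_component fun h ↦ ?_
    change J.componentₗ h _ = _
    rw [map_sum]
    exact (Finset.sum_eq_single h (fun g _ hg ↦ component_insert_of_ne J hg.symm _)
      (fun hh ↦ absurd (Finset.mem_univ h) hh)).trans (component_insert_self J h _)
  · rw [← map_one (Mloc.of J.cross), hE, component_one_self, map_one]
  · rw [← map_one (Mloc.of J.cross), hE, component_one_of_ne _ hg, map_zero]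
  · refine Mloc.induction_of cross (exists_le_cross (α := α) hA)
      (p := fun x ↦ E g (x * Mloc.coe _ (CrossedProduct.embed α a)) =
        E g x * Mloc.coe A (α g a)) x
      (isClosed_eq (by fun_prop) (by fun_prop)) fun J m ↦ ?_
    rw [Mloc.coe_eq_of_mult J.cross, ← map_mul, hE, hE, component_mul_mult, map_mul,
      ← Mloc.coe_eq_of_mult]
  · refine Mloc.induction_of cross (exists_le_cross (α := α) hA)
      (p := fun x ↦ E g (Mloc.coe _ (CrossedProduct.embed α a) * x) =
        Mloc.coe A a * E g x) x
      (isClosed_eq (by fun_prop) (by fun_prop)) fun J m ↦ ?_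
    rw [Mloc.coe_eq_of_mult J.cross, ← map_mul, hE, hE, component_mult_mul, map_mul,
      ← Mloc.coe_eq_of_mult]

/-! ### The two implications -/

theorem subsingleton_mloc [Subsingleton A] : Subsingleton (Mloc A) := by
  refine subsingleton_of_zero_eq_one ?_
  rw [← map_zero (Mloc.of (EssIdeal.whole A)), ← map_one (Mloc.of (EssIdeal.whole A))]
  exact congrArg _ (ext_fst fun x ↦ Subtype.ext (Subsingleton.elim _ _))

/-- Each coefficient of an element of the commutant intertwines the identity and α_g, so proper
outerness kills it for g ≠ e. The remaining coefficient commutes with A and is a scalar. The case A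
= 0 is separate, as the decomposition assumes A nontrivial. -/
theorem ProperlyOuter.strictlyOuter (hA : IsPrimeCStar A) (h : ProperlyOuter α) :
    StrictlyOuter α := by
  refine Set.Subset.antisymm (fun x hx ↦ ?_) ?_
  · cases subsingleton_or_nontrivial A with
    | inl _ =>
      have : Subsingleton (CrossedProduct α) := inferInstanceAs (Subsingleton (G → A))
      have := subsingleton_mloc (A := CrossedProduct α)
      exact ⟨0, Subsingleton.elim _ _⟩
    | inr _ =>
      obtain ⟨E, W, -, -, hsum, hone, hne, hr, hl⟩ := exists_fourier (α := α) hA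
      have hcomm : ∀ g a, E g x * Mloc.coe A (α g a) = Mloc.coe A a * E g x := fun g a ↦ by
        rw [← hr, ← hl, mem_centralizer_iff.1 hx]
      have hz : ∀ g, g ≠ 1 → E g x = 0 := fun g hg ↦
        (eq_zero_or_exists_unitary hA (α g) (hcomm g)).resolve_right (h g hg)
      obtain ⟨c, hc⟩ := Mloc.exists_eq_algebraMap hA (x := E 1 x) fun a ↦ by
        have := hcomm 1 a
        rwa [CrossedProduct.one_apply] at this
      have key : ∀ y, (∀ g, g ≠ 1 → E g y = 0) → W 1 (E 1 y) = y := fun y hy ↦ by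
        conv_rhs => rw [← hsum y]
        rw [Finset.sum_eq_single 1 (fun g _ hg ↦ by rw [hy g hg, map_zero]) (by simp)]
      refine ⟨c, ?_⟩
      rw [← key x hz, hc, Algebra.algebraMap_eq_smul_one, Algebra.algebraMap_eq_smul_one, map_smul,
        ← hone, key 1 hne]
  · rintro _ ⟨c, rfl⟩
    exact mem_centralizer_iff.2 fun a ↦ (Algebra.commutes c _).symm

/-- If u implements α_g, then u* α_g(a) = a u*, so u* λ_g commutes with A and must be a scalar. Its
g-coefficient is then zero, giving u* = 0 and A = 0. Faithfulness settles the case A = 0 by forcing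
G to be trivial. -/
theorem StrictlyOuter.properlyOuter (hA : IsPrimeCStar A) (hα : Function.Injective α)
    (h : StrictlyOuter α) : ProperlyOuter α := by
  rintro g hg ⟨u, hu, hua⟩
  cases subsingleton_or_nontrivial A with
  | inl _ => exact hg (hα (DFunLike.ext _ _ fun a ↦ Subsingleton.elim _ _))
  | inr _ =>
    obtain ⟨E, W, h1, h2, hsum, -, hne, hr, hl⟩ := exists_fourier (α := α) hA
    have hx : W g (star u) ∈ Set.range (algebraMap ℂ (Mloc (CrossedProduct α))) := by
      rw [← h, mem_centralizer_iff]
      intro a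
      refine (hsum _).symm.trans
        ((Finset.sum_congr rfl fun k _ ↦ congrArg (W k) ?_).trans (hsum _))
      rw [hl, hr]
      by_cases hk : k = g
      · subst hk
        rw [h1, hua, ← mul_assoc, ← mul_assoc, Unitary.star_mul_self_of_mem hu, one_mul]
      · rw [h2 g k hk, mul_zero, zero_mul]
    obtain ⟨c, hc⟩ := hx
    have hu0 : star u = 0 := by
      rw [← h1 g (star u), ← hc, Algebra.algebraMap_eq_smul_one, map_smul, hne g hg, smul_zero]
    obtain ⟨a, ha⟩ := exists_ne (0 : A)
    have h10 : (1 : Mloc A) = 0 := by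
      rw [← Unitary.star_mul_self_of_mem hu, hu0, zero_mul]
    refine ha (norm_eq_zero.1 ?_)
    rw [← Mloc.norm_coe, ← mul_one (Mloc.coe A a), h10, mul_zero, norm_zero]

end Fourier

end CStarDynamics
end

theorem theorem11 {A : Type*} [NonUnitalCStarAlgebra A] {G : Type*} [Group G] [Fintype G]
    (α : G →* (A ≃⋆ₐ[ℂ] A)) (hA : CStarDynamics.IsPrimeCStar A) (hα : Function.Injective α) :
    CStarDynamics.ProperlyOuter α ↔ CStarDynamics.StrictlyOuter α := by
  exact ⟨fun h ↦ h.strictlyOuter hA, fun h ↦ h.properlyOuter hA hα⟩
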